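/- Let $H$ be a fixed finite simple graph with $v_H$ vertices. For a graph $G$ let $v_G,e_G$ be its numbers of vertices and edges, and let $d^*=\max_{G\subseteq H} e_G/(v_G-1)$ be the maximum $1$-density of $H$ (the maximum is over all, not necessarily induced, subgraphs $G$; subgraphs with at most one vertex count as having density $0$). Equip the complete graph $K_n$ with i.i.d. edge weights $(X_e)$. For $0\le k\le n$, let $F_H(k,n)$ be the minimum of $W_Q=\sum_{H'\in Q}\sum_{e\in E(H')}X_e$ over all collections $Q$ of pairwise vertex-disjoint subgraphs of $K_n$, each isomorphic to $H$, that leave at most $k$ vertices of $K_n$ uncovered; write $F_H(n)=F_H(0,n)$. Below, $n\to\infty$ along the multiples of $v_H$. An event has probability $1-n^{-\omega(1)}$ if for every $K$ its complement has probability at most $n^{-K}$ for all sufficiently large $n$; and $Y_n=O_{\mathbb P}(Z_n)$ means that for every $\varepsilon>0$ there is a $C$ with $\Pr(|Y_n|>C|Z_n|)<\varepsilon$ for all sufficiently large $n$. Then $d^*>1$ if and only if $H$ contains a cycle. Assume $d^*>1$. Then: (1) Let the edge weights be $\mathrm{Exp}(1)$-distributed. For every $\alpha\in[0,1)$ there are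 constants $0<a<b$ (depending only on $H$ and $\alpha$) such that $$a\,n^{1-1/d^*}\le F_H(\alpha n,n)\le b\,n^{1-1/d^*}$$ with probability $1-n^{-\omega(1)}$. Furthermore, if $M=M(n)$ denotes the median of $F_H(\alpha n,n)$, then $$|F_H(\alpha n,n)-M|=O_{\mathbb P}(M^{3/4}).$$ (2) Let the edge weights be either uniform on $[0,1]$ or $\mathrm{Exp}(1)$-distributed. Then there is a deterministic sequence $M=M(n)\ge 0$ with $M=\Theta(n^{1-1/d^*})$ such that $$|F_H(n)-M|=O_{\mathbb P}(M^{3/4}).$$ -/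

import Mathlib

open Filter Set MeasureTheory ProbabilityTheory

/-- The maximum `1`-density `d^* = max { e_G / (v_G - 1) : G ⊆ H }` over all (not necessarily
induced) subgraphs `G` of the finite graph `H`. Subgraphs with at most one vertex have no edges
and contribute the value `0`, so they do not influence the maximum when `H` has two vertices. -/
noncomputable def maxDensity {V : Type*} (H : SimpleGraph V) : ℝ :=
  ⨆ G : H.Subgraph, (G.edgeSet.ncard : ℝ) / ((G.verts.ncard : ℝ) - 1)

/-- The complete graph `K_n` on the vertex set `Fin n`. -/
abbrev Kn (n : ℕ) : SimpleGraph (Fin n) := ⊤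

/-- The edges of `K_n`. -/
abbrev KnEdge (n : ℕ) : Type := (Kn n).edgeSet

/-- `Q` is an `(α, H)`-factor of `K_n`: a set of pairwise vertex-disjoint subgraphs of `K_n`, each
isomorphic to `H`, which together cover at least `(1 - α) n` vertices. -/
structure IsPartialFactor {V : Type*} (H : SimpleGraph V) (n : ℕ) (α : ℝ)
    (Q : Finset (Kn n).Subgraph) : Prop where
  iso : ∀ G ∈ Q, Nonempty (G.coe ≃g H)
  disjoint : ∀ G ∈ Q, ∀ G' ∈ Q, G ≠ G' → Disjoint G.verts G'.verts
  cover : (1 - α) * n ≤ ((⋃ G ∈ Q, G.verts).ncard : ℝ)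

open Classical in
/-- The weight `W_Q = ∑_{H' ∈ Q} ∑_{e ∈ E(H')} x_e` for edge weights `x` on `K_n`. -/
noncomputable def totalWeight {n : ℕ} (x : KnEdge n → ℝ) (Q : Finset (Kn n).Subgraph) : ℝ :=
  ∑ G ∈ Q, ∑ e : KnEdge n, if (e : Sym2 (Fin n)) ∈ G.edgeSet then x e else 0

/-- `F_H(k, n)`: the minimum weight of a `(k / n, H)`-factor of `K_n` with edge weights `x`
(a minimum over a finite set, which is nonempty whenever `v_H` divides `n` and `0 ≤ k`). -/
noncomputable def minFactorWeight {V : Type*} (H : SimpleGraph V) (k : ℝ) (n : ℕ)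
    (x : KnEdge n → ℝ) : ℝ :=
  sInf (totalWeight x '' {Q | IsPartialFactor H n (k / n) Q})

/-- The random variables `X e`, indexed by the edges of `K_n`, are i.i.d. with law `ν`. -/
def IsIIDWeights {n : ℕ} {Ω : Type*} [MeasurableSpace Ω] (P : Measure Ω)
    (X : KnEdge n → Ω → ℝ) (ν : Measure ℝ) : Prop :=
  iIndepFun X P ∧ ∀ e, HasLaw (X e) ν P

/-- `m` is a median of the random variable `Y`. -/
def IsMedian {Ω : Type*} [MeasurableSpace Ω] (P : Measure Ω) (Y : Ω → ℝ) (m : ℝ) : Prop :=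
  1 / 2 ≤ P.real {ω | Y ω ≤ m} ∧ 1 / 2 ≤ P.real {ω | m ≤ Y ω}

/-- The filter of natural numbers tending to infinity along the multiples of `v`. -/
def multiplesAtTop (v : ℕ) : Filter ℕ := atTop ⊓ 𝓟 {n | v ∣ n}

/-- Along `l`, the event `A n` has probability `1 - n^{-ω(1)}`: the probability of its complement
is eventually at most `n^{-K}`, for every `K`. -/
def HoldsWithVeryHighProb (l : Filter ℕ) {Ω : ℕ → Type*} [∀ n, MeasurableSpace (Ω n)]
    (P : ∀ n, Measure (Ω n)) (A : ∀ n, Set (Ω n)) : Prop :=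
  ∀ K : ℝ, ∀ᶠ n in l, (P n).real (A n)ᶜ ≤ (n : ℝ) ^ (-K)

/-- `Y_n = O_ℙ(Z_n)` along `l`. -/
def IsBigOInProb (l : Filter ℕ) {Ω : ℕ → Type*} [∀ n, MeasurableSpace (Ω n)]
    (P : ∀ n, Measure (Ω n)) (Y Z : ∀ n, Ω n → ℝ) : Prop :=
  ∀ ε : ℝ, 0 < ε → ∃ C : ℝ, ∀ᶠ n in l, (P n).real {ω | C * |Z n ω| < |Y n ω|} < ε

/-!
Write `v = v_H` and `L = n ^ (1 - 1/d^*)`. All probabilities are computed for the product measure on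
edge weights `KnEdge n → ℝ`, and only a few properties of the edge law are used (`IsEdgeLaw`):
nonnegativity, a distribution function comparable to the identity near `0`, an exponential tail and
a second moment.

*Upper tail* (`upper_tail`). Janson's inequality (`janson`), which is derived from the FKG
inequality, shows that a set of `m` vertices contains no copy of `H` with all weights at most
`C m ^ (-1/d^*)` with probability at most `exp (-c C m)`; here the definition of `d^*` bounds the
correlations between overlapping copies. If `C` is taken to be a large multiple of `(n / m) ^ δ`,
this beats the number of sets of `m` vertices, so that with very high probability every set of
`m ≥ n ^ ε` vertices contains such a light copy. Removing light copies greedily gives a factor of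
weight `O(∑_m (n / m) ^ δ m ^ (-1/d^*)) = O(L)`; this series is dominated by its large terms because
`d^* > 1`, and the last `n ^ ε` vertices may be covered at arbitrary cost. No separate treatment of
full factors is needed.

*Lower tail* (`lower_tail`). A factor of weight `a L` contains linearly many disjoint copies of a
densest subgraph of `H` with weights at most `p = a' n ^ (-1/d^*)`. The expected number of copies of
that subgraph with weights at most `p` is at most `a' n`, and a first moment bound for families of
disjoint copies excludes this when `a'` is small.

*Concentration* (`variance_minSum_le`). The minimum weight is a minimum of subset sums of
independent weights, because the members of a factor are edge-disjoint. By the Efron–Stein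
inequality (`efronStein`) its variance is at most a sum of contributions of the single edges. As a
function of one weight the minimum has the form `A + min t T`, and the variance of such a function
is at most a constant times the expected increase when the weight is doubled. Doubling the weight of
an edge outside an optimal factor changes nothing, and doubling that of an edge `e` inside costs at
most `x e`; so these increases add up to at most the minimum itself. Thus the variance is at most a
constant times the expectation, and the fluctuations are `O(L ^ (1/2))`, which is smaller than
`L ^ (3/4)`.
-/

/-! ### Janson's inequality for binomial random subsets -/

section Janson

variable {E : Type*} [Fintype E] [DecidableEq E]

/-- The probability of the outcome `R` for the binomial random subset of `E` that contains each
element independently with probability `q`. -/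
noncomputable def binomWeight (q : ℝ) (R : Finset E) : ℝ := ∏ e, if e ∈ R then q else 1 - q

lemma binomWeight_nonneg {q : ℝ} (h0 : 0 ≤ q) (h1 : q ≤ 1) (R : Finset E) :
    0 ≤ binomWeight q R :=
  Finset.prod_nonneg fun e _ => by split_ifs <;> linarith

lemma binomWeight_mul (q : ℝ) (R S : Finset E) :
    binomWeight q R * binomWeight q S = binomWeight q (R ⊓ S) * binomWeight q (R ⊔ S) := by
  simp only [binomWeight, ← Finset.prod_mul_distrib]
  refine Finset.prod_congr rfl fun e _ => ?_
  by_cases hR : e ∈ R <;> by_cases hS : e ∈ S <;> simp [hR, hS, mul_comm]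

lemma sum_binomWeight_mul_split (q : ℝ) (e : E) (h : Finset E → ℝ) :
    ∑ R, binomWeight q R * h R = ∑ R ∈ (Finset.univ.erase e).powerset,
      (∏ i ∈ Finset.univ.erase e, if i ∈ R then q else 1 - q) *
        (q * h (insert e R) + (1 - q) * h R) := by
  have hu : (Finset.univ : Finset (Finset E)) = (insert e (Finset.univ.erase e)).powerset := by
    ext R; simp [Finset.insert_erase]
  rw [hu, Finset.sum_powerset_insert (Finset.notMem_erase e _), ← Finset.sum_add_distrib]
  refine Finset.sum_congr rfl fun R hR => ?_
  have he : e ∉ R := fun h => by simpa using Finset.mem_powerset.1 hR h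
  have h1 : binomWeight q R
      = (1 - q) * ∏ i ∈ Finset.univ.erase e, if i ∈ R then q else 1 - q := by
    rw [binomWeight, ← Finset.mul_prod_erase _ _ (Finset.mem_univ e), if_neg he]
  have h2 : binomWeight q (insert e R)
      = q * ∏ i ∈ Finset.univ.erase e, if i ∈ R then q else 1 - q := by
    rw [binomWeight, ← Finset.mul_prod_erase _ _ (Finset.mem_univ e),
      if_pos (Finset.mem_insert_self e R)]
    congr 1
    refine Finset.prod_congr rfl fun i hi => ?_
    simp [Finset.ne_of_mem_erase hi]
  rw [h1, h2]; ring

lemma sum_binomWeight_indicator (q : ℝ) (A : Finset E) (g : Finset E → ℝ)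
    (hg : ∀ e ∈ A, ∀ R, g (insert e R) = g R) :
    ∑ R, binomWeight q R * ((if A ⊆ R then 1 else 0) * g R)
      = q ^ A.card * ∑ R, binomWeight q R * g R := by
  induction A using Finset.induction_on with
  | empty => simp
  | insert e A he ih =>
    have ih' := ih fun e' he' => hg e' (Finset.mem_insert_of_mem he')
    have hge := hg e (Finset.mem_insert_self e A)
    rw [Finset.card_insert_of_notMem he, pow_succ, mul_right_comm, ← ih',
      sum_binomWeight_mul_split q e, sum_binomWeight_mul_split q e, Finset.sum_mul]
    refine Finset.sum_congr rfl fun R hR => ?_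
    have heR : e ∉ R := fun h => by simpa using Finset.mem_powerset.1 hR h
    have h1 : insert e A ⊆ insert e R ↔ A ⊆ R := Finset.insert_subset_insert_iff he
    have h2 : ¬ insert e A ⊆ R := fun h => heR (h (Finset.mem_insert_self e A))
    have h3 : A ⊆ insert e R ↔ A ⊆ R := Finset.subset_insert_iff_of_notMem he
    simp only [h1, h2, h3, hge]
    simp only [if_false]
    ring

lemma sum_binomWeight (q : ℝ) : ∑ R : Finset E, binomWeight q R = 1 := by
  have := Finset.prod_add (fun _ : E => q) (fun _ => 1 - q) Finset.univ
  simp only [add_sub_cancel, Finset.prod_const_one, Finset.powerset_univ] at this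
  rw [this]
  refine Finset.sum_congr rfl fun R _ => ?_
  rw [binomWeight, ← Finset.prod_mul_prod_compl R, Finset.compl_eq_univ_sdiff]
  congr 1
  · exact Finset.prod_congr rfl fun i hi => by simp [hi]
  · exact Finset.prod_congr rfl fun i hi => by simp [(Finset.mem_sdiff.1 hi).2]

lemma sum_binomWeight_subset (q : ℝ) (A : Finset E) :
    ∑ R, binomWeight q R * (if A ⊆ R then 1 else 0) = q ^ A.card := by
  have := sum_binomWeight_indicator q A (fun _ => 1) (fun _ _ _ => rfl)
  simpa [sum_binomWeight] using this

/-- Harris's inequality for decreasing functions, conditionally on the presence of a set `A`. -/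
lemma harris_conditional {q : ℝ} (h0 : 0 ≤ q) (h1 : q ≤ 1) (A : Finset E)
    {f g : Finset E → ℝ} (hf0 : 0 ≤ f) (hg0 : 0 ≤ g) (hf : Antitone f) (hg : Antitone g) :
    (∑ R, binomWeight q R * ((if A ⊆ R then 1 else 0) * f R)) *
      (∑ R, binomWeight q R * ((if A ⊆ R then 1 else 0) * g R)) ≤
    q ^ A.card * ∑ R, binomWeight q R * ((if A ⊆ R then 1 else 0) * (f R * g R)) := by
  have key := fkg (α := (Finset E)ᵒᵈ)
    (μ := fun R => binomWeight q (OrderDual.ofDual R) *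
      (if A ⊆ OrderDual.ofDual R then (1 : ℝ) else 0))
    (f := fun R => f (OrderDual.ofDual R)) (g := fun R => g (OrderDual.ofDual R))
    (fun R => mul_nonneg (binomWeight_nonneg h0 h1 _) (by dsimp; split_ifs <;> norm_num))
    (fun R => hf0 _) (fun R => hg0 _) (fun R S h => hf h) (fun R S h => hg h) ?_
  · rw [← sum_binomWeight_subset q A]
    simp only [← mul_assoc] at key ⊢
    exact key
  · intro R S
    have e1 : OrderDual.ofDual (R ⊓ S) = OrderDual.ofDual R ⊔ OrderDual.ofDual S := rfl
    have e2 : OrderDual.ofDual (R ⊔ S) = OrderDual.ofDual R ⊓ OrderDual.ofDual S := rfl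
    rw [e1, e2]
    generalize OrderDual.ofDual R = R'
    generalize OrderDual.ofDual S = S'
    rw [mul_mul_mul_comm, binomWeight_mul, mul_mul_mul_comm (binomWeight q (R' ⊔ S')),
      mul_comm (binomWeight q (R' ⊔ S'))]
    refine mul_le_mul_of_nonneg_left ?_
      (mul_nonneg (binomWeight_nonneg h0 h1 _) (binomWeight_nonneg h0 h1 _))
    by_cases hR : A ⊆ R'
    · by_cases hS : A ⊆ S'
      · have h3 : A ⊆ R' ⊔ S' := hR.trans le_sup_left
        have h4 : A ⊆ R' ⊓ S' := le_inf hR hS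
        rw [if_pos hR, if_pos hS, if_pos h3, if_pos h4]
      · simp only [hS, if_false, mul_zero]; positivity
    · simp only [hR, if_false, zero_mul]; positivity

/-- **Janson's inequality**, in the form that keeps the parameter of the exponential moment free.
The proof bounds the logarithmic derivative of `s ↦ 𝔼 exp (-s X)`, where `X` counts the sets `A i`
contained in the random set. -/
theorem janson {I : Type*} [Fintype I] (A : I → Finset E) {q : ℝ} (h0 : 0 < q) (h1 : q ≤ 1)
    {s : ℝ} (hs : 0 ≤ s) :
    ∑ R, binomWeight q R * (if ∀ i, ¬ A i ⊆ R then 1 else 0) ≤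
      Real.exp (-(s * ∑ i, q ^ (A i).card) + s ^ 2 / 2 *
        ∑ i, ∑ j, if (A i ∩ A j).Nonempty then q ^ (A i ∪ A j).card else 0) := by
  classical
  set m := ∑ i, q ^ (A i).card with hm
  set D := ∑ i, ∑ j, if (A i ∩ A j).Nonempty then q ^ (A i ∪ A j).card else 0 with hD
  let I' : I → Finset E → ℝ := fun i R => if A i ⊆ R then 1 else 0
  have hI0 : ∀ i R, 0 ≤ I' i R := fun i R => by dsimp [I']; split_ifs <;> norm_num
  have hImono : ∀ i, Monotone (I' i) := fun i R S h => by
    dsimp [I']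
    by_cases hR : A i ⊆ R
    · rw [if_pos hR, if_pos (hR.trans h)]
    · rw [if_neg hR]; split_ifs <;> norm_num
  let X : Finset E → ℝ := fun R => ∑ i, I' i R
  let Y : I → Finset E → ℝ := fun i R => ∑ j, if (A i ∩ A j).Nonempty then I' j R else 0
  let Z : I → Finset E → ℝ := fun i R => ∑ j, if (A i ∩ A j).Nonempty then 0 else I' j R
  have hXYZ : ∀ i R, X R = Y i R + Z i R := fun i R => by
    dsimp only [X, Y, Z]
    rw [← Finset.sum_add_distrib]
    exact Finset.sum_congr rfl fun j _ => by split_ifs <;> simp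
  have hY0 : ∀ i R, 0 ≤ Y i R := fun i R =>
    Finset.sum_nonneg fun j _ => by split_ifs; exacts [hI0 _ _, le_rfl]
  have hYmono : ∀ i, Monotone (Y i) := fun i R S h =>
    Finset.sum_le_sum fun j _ => by split_ifs; exacts [hImono _ h, le_rfl]
  have hZmono : ∀ i, Monotone (Z i) := fun i R S h =>
    Finset.sum_le_sum fun j _ => by split_ifs; exacts [le_rfl, hImono _ h]
  have hZind : ∀ i, ∀ e ∈ A i, ∀ R, Z i (insert e R) = Z i R := fun i e he R => by
    refine Finset.sum_congr rfl fun j _ => ?_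
    split_ifs with h
    · rfl
    · have : e ∉ A j := fun hj => h ⟨e, Finset.mem_inter.2 ⟨he, hj⟩⟩
      simp only [I', Finset.subset_insert_iff_of_notMem this]
  let Psi : ℝ → ℝ := fun t => ∑ R, binomWeight q R * Real.exp (-(t * X R))
  let Psi' : ℝ → ℝ := fun t => ∑ R, binomWeight q R * (Real.exp (-(t * X R)) * -X R)
  have hPsi : ∀ t, HasDerivAt Psi (Psi' t) t := fun t => by
    refine HasDerivAt.fun_sum fun R _ => ?_
    refine HasDerivAt.const_mul _ ?_
    have := ((hasDerivAt_id t).mul_const (X R)).neg.exp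
    simpa using this
  have hw := fun R : Finset E => binomWeight_nonneg h0.le h1 R
  have step : ∀ t, 0 ≤ t → ∀ i,
      (q ^ (A i).card - t * ∑ j, if (A i ∩ A j).Nonempty then q ^ (A i ∪ A j).card else 0) * Psi t
        ≤ ∑ R, binomWeight q R * (I' i R * Real.exp (-(t * X R))) := by
    intro t ht i
    have hc : 0 < q ^ (A i).card := pow_pos h0 _
    -- given `A i ⊆ R`, the parts of `X` that meet and that avoid `A i` are positively correlated
    have H := harris_conditional h0.le h1 (A i) (f := fun R => Real.exp (-(t * Y i R)))
      (g := fun R => Real.exp (-(t * Z i R))) (fun R => (Real.exp_pos _).le)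
      (fun R => (Real.exp_pos _).le)
      (fun R S h => Real.exp_le_exp.2 (neg_le_neg (mul_le_mul_of_nonneg_left (hYmono i h) ht)))
      (fun R S h => Real.exp_le_exp.2 (neg_le_neg (mul_le_mul_of_nonneg_left (hZmono i h) ht)))
    rw [sum_binomWeight_indicator q (A i) (fun R => Real.exp (-(t * Z i R)))
      (fun e he R => by simp only [hZind i e he R])] at H
    have H' : (∑ R, binomWeight q R * (I' i R * Real.exp (-(t * Y i R)))) *
        (∑ R, binomWeight q R * Real.exp (-(t * Z i R)))
        ≤ ∑ R, binomWeight q R * (I' i R * Real.exp (-(t * X R))) := by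
      have e1 : ∀ R, Real.exp (-(t * X R)) = Real.exp (-(t * Y i R)) * Real.exp (-(t * Z i R)) := by
        intro R; rw [← Real.exp_add, hXYZ i R]; congr 1; ring
      simp only [e1]
      refine le_of_mul_le_mul_left ?_ hc
      calc _ = _ := by ring
        _ ≤ _ := H
    have hYs : q ^ (A i).card - t * (∑ j, if (A i ∩ A j).Nonempty then q ^ (A i ∪ A j).card else 0)
        ≤ ∑ R, binomWeight q R * (I' i R * Real.exp (-(t * Y i R))) := by
      have e2 : ∑ R, binomWeight q R * (I' i R * (1 - t * Y i R)) = q ^ (A i).card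
          - t * (∑ j, if (A i ∩ A j).Nonempty then q ^ (A i ∪ A j).card else 0) := by
        have : ∀ R, binomWeight q R * (I' i R * (1 - t * Y i R)) = binomWeight q R * I' i R
            - t * ∑ j, (if (A i ∩ A j).Nonempty then
                binomWeight q R * (if A i ∪ A j ⊆ R then 1 else 0) else 0) := by
          intro R
          have : I' i R * Y i R = ∑ j, if (A i ∩ A j).Nonempty then
                (if A i ∪ A j ⊆ R then 1 else 0) else 0 := by
            dsimp only [Y]
            rw [Finset.mul_sum]
            refine Finset.sum_congr rfl fun j _ => ?_
            split_ifs with a b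
            · rw [Finset.union_subset_iff] at b
              simp [I', b.1, b.2]
            · rw [Finset.union_subset_iff] at b
              dsimp only [I']; split_ifs <;> simp_all
            · simp
          have h3 : ∑ j, (if (A i ∩ A j).Nonempty then
                binomWeight q R * (if A i ∪ A j ⊆ R then 1 else 0) else 0)
              = binomWeight q R * (I' i R * Y i R) := by
            rw [this, Finset.mul_sum]
            exact Finset.sum_congr rfl fun j _ => by split_ifs <;> simp
          rw [h3]; ring
        simp only [this, Finset.sum_sub_distrib]
        rw [← Finset.mul_sum, Finset.sum_comm, sum_binomWeight_subset]
        congr 2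
        refine Finset.sum_congr rfl fun j _ => ?_
        split_ifs
        · exact sum_binomWeight_subset q _
        · simp
      rw [← e2]
      refine Finset.sum_le_sum fun R _ => mul_le_mul_of_nonneg_left
        (mul_le_mul_of_nonneg_left ?_ (hI0 i R)) (hw R)
      -- only `exp (-y) ≥ 1 - y` is used, which is sharp enough for small `s`
      have := Real.add_one_le_exp (-(t * Y i R))
      linarith
    have hZs : Psi t ≤ ∑ R, binomWeight q R * Real.exp (-(t * Z i R)) := by
      refine Finset.sum_le_sum fun R _ => mul_le_mul_of_nonneg_left (Real.exp_le_exp.2 ?_) (hw R)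
      rw [hXYZ i R]
      have := mul_nonneg ht (hY0 i R)
      linarith
    have hPsi0 : 0 ≤ Psi t := Finset.sum_nonneg fun R _ => mul_nonneg (hw R) (Real.exp_pos _).le
    refine le_trans (mul_le_mul_of_nonneg_right hYs hPsi0) (le_trans ?_ H')
    exact mul_le_mul_of_nonneg_left hZs (Finset.sum_nonneg fun R _ =>
      mul_nonneg (hw R) (mul_nonneg (hI0 i R) (Real.exp_pos _).le))
  have hder : ∀ t, 0 ≤ t → Psi' t + (m - t * D) * Psi t ≤ 0 := by
    intro t ht
    have e : Psi' t = -∑ i, ∑ R, binomWeight q R * (I' i R * Real.exp (-(t * X R))) := by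
      dsimp only [Psi', X]
      rw [Finset.sum_comm, ← Finset.sum_neg_distrib]
      refine Finset.sum_congr rfl fun R _ => ?_
      rw [← Finset.mul_sum, ← Finset.sum_mul]; ring
    have := Finset.sum_le_sum fun i (_ : i ∈ Finset.univ) => step t ht i
    rw [← Finset.sum_mul, Finset.sum_sub_distrib, ← Finset.mul_sum] at this
    rw [e]; linarith
  -- the differential inequality makes this comparison function decreasing
  let h : ℝ → ℝ := fun t => Psi t * Real.exp (m * t - t ^ 2 / 2 * D)
  have hh : ∀ t, HasDerivAt h ((Psi' t + (m - t * D) * Psi t) * Real.exp (m * t - t ^ 2 / 2 * D))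
      t := by
    intro t
    have h1 : HasDerivAt (fun t : ℝ => m * t - t ^ 2 / 2 * D) (m - t * D) t := by
      have := ((hasDerivAt_id t).const_mul m).sub
        ((((hasDerivAt_id t).pow 2).div_const 2).mul_const D)
      convert! this using 1
      simp
    have := (hPsi t).mul h1.exp
    convert! this using 1
    ring
  have hanti : AntitoneOn h (Ici 0) := by
    refine antitoneOn_of_deriv_nonpos (convex_Ici 0)
      (fun t _ => (hh t).continuousAt.continuousWithinAt)
      (fun t _ => (hh t).differentiableAt.differentiableWithinAt) fun t ht => ?_
    rw [(hh t).deriv]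
    rw [interior_Ici] at ht
    exact mul_nonpos_of_nonpos_of_nonneg (hder t (le_of_lt ht)) (Real.exp_pos _).le
  have hle := hanti (mem_Ici.2 le_rfl) (mem_Ici.2 hs) hs
  have hzero : h 0 = 1 := by simp [h, Psi, sum_binomWeight]
  rw [hzero] at hle
  have hfin : Psi s ≤ Real.exp (-(s * m) + s ^ 2 / 2 * D) := by
    have e3 : -(s * m) + s ^ 2 / 2 * D = -(m * s - s ^ 2 / 2 * D) := by ring
    rw [e3, Real.exp_neg, ← one_div, le_div_iff₀ (Real.exp_pos _)]
    exact hle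
  refine le_trans (Finset.sum_le_sum fun R _ => mul_le_mul_of_nonneg_left ?_ (hw R)) hfin
  split_ifs with hR
  · have : X R = 0 := Finset.sum_eq_zero fun i _ => by simp [I', hR i]
    simp [this]
  · exact (Real.exp_pos _).le

end Janson

/-! ### Sublevel sets of independent weights -/

section Threshold

variable {E : Type*} [Fintype E] [DecidableEq E] (ν : Measure ℝ) [IsProbabilityMeasure ν]

lemma measureReal_threshold_eq (p : ℝ) (R : Finset E) :
    (Measure.pi fun _ : E => ν).real {x | Finset.univ.filter (fun e => x e ≤ p) = R}
      = binomWeight (ν.real (Iic p)) R := by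
  have h : {x : E → ℝ | Finset.univ.filter (fun e => x e ≤ p) = R}
      = Set.pi univ fun e => if e ∈ R then Iic p else Ioi p := by
    ext x
    simp only [mem_ofPred_eq, Finset.ext_iff, Finset.mem_filter, Finset.mem_univ, true_and,
      Set.mem_pi, mem_univ, forall_true_left]
    refine forall_congr' fun e => ?_
    by_cases he : e ∈ R <;> simp [he]
  rw [h, Measure.real, Measure.pi_pi, ENNReal.toReal_prod, binomWeight]
  refine Finset.prod_congr rfl fun e _ => ?_
  split_ifs
  · rfl
  · rw [← compl_Iic, ← Measure.real, measureReal_compl measurableSet_Iic, probReal_univ]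

omit [DecidableEq E] in
lemma measurableSet_threshold (p : ℝ) (R : Finset E) :
    MeasurableSet {x : E → ℝ | Finset.univ.filter (fun e => x e ≤ p) = R} := by
  have h : {x : E → ℝ | Finset.univ.filter (fun e => x e ≤ p) = R}
      = ⋂ e, {x | x e ≤ p ↔ e ∈ R} := by
    ext x
    simp [Finset.ext_iff]
  rw [h]
  refine MeasurableSet.iInter fun e => ?_
  by_cases he : e ∈ R
  · simpa [he] using measurableSet_le (measurable_pi_apply e) measurable_const
  · simpa [he] using measurableSet_lt measurable_const (measurable_pi_apply e)

/-- Janson's inequality for the random set of the indices whose weight is at most `p`. -/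
theorem janson_pi {I : Type*} [Fintype I] (A : I → Finset E) {p q : ℝ} (hq : ν.real (Iic p) = q)
    (h0 : 0 < q) {s : ℝ} (hs : 0 ≤ s) :
    (Measure.pi fun _ : E => ν).real {x | ∀ i, ∃ e ∈ A i, p < x e} ≤
      Real.exp (-(s * ∑ i, q ^ (A i).card) + s ^ 2 / 2 *
        ∑ i, ∑ j, if (A i ∩ A j).Nonempty then q ^ (A i ∪ A j).card else 0) := by
  classical
  have h1 : q ≤ 1 := hq ▸ measureReal_le_one
  refine le_trans (le_of_eq ?_) (janson A h0 h1 hs)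
  have h : {x : E → ℝ | ∀ i, ∃ e ∈ A i, p < x e}
      = ⋃ R ∈ (Finset.univ.filter fun R : Finset E => ∀ i, ¬ A i ⊆ R),
        {x | Finset.univ.filter (fun e => x e ≤ p) = R} := by
    ext x
    simp [Finset.subset_iff]
  rw [h, measureReal_biUnion_finset]
  · rw [Finset.sum_filter]
    refine Finset.sum_congr rfl fun R _ => ?_
    rw [measureReal_threshold_eq, hq]
    split_ifs <;> simp
  · intro R _ S _ hRS
    refine Set.disjoint_left.2 fun x hx hx' => hRS ?_
    rw [← hx.out, ← hx'.out]
  · exact fun R _ => measurableSet_threshold p R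

omit [DecidableEq E] in
lemma measureReal_pi_forall_mem_le (A : Finset E) (p : ℝ) :
    (Measure.pi fun _ : E => ν).real {x | ∀ e ∈ A, x e ≤ p} = ν.real (Iic p) ^ A.card := by
  classical
  have h : {x : E → ℝ | ∀ e ∈ A, x e ≤ p}
      = Set.pi univ fun e => if e ∈ A then Iic p else univ := by
    ext x
    simp only [mem_ofPred_eq, Set.mem_pi, mem_univ, forall_true_left]
    refine forall_congr' fun e => ?_
    by_cases he : e ∈ A <;> simp [he]
  rw [h, Measure.real, Measure.pi_pi, ENNReal.toReal_prod, ← Finset.prod_const,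
    ← Finset.prod_subset (Finset.subset_univ A)]
  · exact Finset.prod_congr rfl fun e he => by rw [if_pos he]; rfl
  · intro e _ he; simp [he]

end Threshold

/-! ### The Efron–Stein inequality for Lipschitz functions -/

section EfronStein

open scoped NNReal

variable {ι : Type*} [Fintype ι] [DecidableEq ι] (ν : Measure ℝ) [IsProbabilityMeasure ν]

lemma measurePreserving_update_prod (i : ι) :
    MeasurePreserving (fun z : (ι → ℝ) × ℝ => Function.update z.1 i z.2)
      ((Measure.pi fun _ : ι => ν).prod ν) (Measure.pi fun _ : ι => ν) := by
  have hm : Measurable (fun z : (ι → ℝ) × ℝ => Function.update z.1 i z.2) := by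
    refine measurable_pi_iff.2 fun j => ?_
    by_cases h : j = i
    · subst h; simpa using measurable_snd
    · simp only [Function.update_of_ne h]
      exact (measurable_pi_apply j).comp measurable_fst
  refine ⟨hm, (Measure.pi_eq fun s hs => ?_).symm⟩
  rw [Measure.map_apply hm (MeasurableSet.univ_pi hs)]
  have : (fun z : (ι → ℝ) × ℝ => Function.update z.1 i z.2) ⁻¹' (Set.pi univ s)
      = (Set.pi univ (Function.update s i univ)) ×ˢ s i := by
    ext z
    simp only [mem_preimage, Set.mem_pi, mem_univ, forall_true_left, mem_prod]
    constructor
    · intro h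
      refine ⟨fun j => ?_, by simpa using h i⟩
      by_cases hj : j = i
      · subst hj; simp
      · simpa [hj] using h j
    · rintro ⟨h1, h2⟩ j
      by_cases hj : j = i
      · subst hj; simpa using h2
      · simpa [hj] using h1 j
  rw [this, Measure.prod_prod, Measure.pi_pi, ← Finset.mul_prod_erase _ _ (Finset.mem_univ i),
    ← Finset.mul_prod_erase Finset.univ (fun j => ν (s j)) (Finset.mem_univ i)]
  simp only [Function.update_self, measure_univ, one_mul]
  rw [mul_comm]
  congr 1
  exact Finset.prod_congr rfl fun j hj => by simp [Finset.ne_of_mem_erase hj]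

omit [DecidableEq ι] in
lemma LipschitzWith.memLp_two_pi (hν : MemLp id 2 ν) {K : ℝ≥0} {f : (ι → ℝ) → ℝ}
    (hf : LipschitzWith K f) : MemLp f 2 (Measure.pi fun _ : ι => ν) := by
  have h1 : ∀ i : ι, MemLp (fun x : ι → ℝ => x i) 2 (Measure.pi fun _ : ι => ν) := fun i =>
    hν.comp_measurePreserving (measurePreserving_eval (fun _ : ι => ν) i)
  have h2a : MemLp (fun _ : ι → ℝ => |f 0|) 2 (Measure.pi fun _ : ι => ν) := memLp_const _
  have h2b : MemLp (fun x : ι → ℝ => ∑ i, |x i|) 2 (Measure.pi fun _ : ι => ν) :=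
    memLp_finsetSum _ fun i _ => (h1 i).norm
  have h2 : MemLp (fun x : ι → ℝ => |f 0| + (K : ℝ) * ∑ i, |x i|) 2
      (Measure.pi fun _ : ι => ν) := h2a.add (h2b.const_mul (K : ℝ))
  refine h2.of_le hf.continuous.aestronglyMeasurable (ae_of_all _ fun x => ?_)
  have h3 : ‖x‖ ≤ ∑ i, |x i| := by
    refine (pi_norm_le_iff_of_nonneg (Finset.sum_nonneg fun i _ => abs_nonneg _)).2 fun i => ?_
    exact Finset.single_le_sum (f := fun i => |x i|) (fun i _ => abs_nonneg _) (Finset.mem_univ i)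
  have h4 := hf.dist_le_mul x 0
  rw [Real.dist_eq, dist_zero_right] at h4
  have h5 : |f x| ≤ |f 0| + |f x - f 0| := by
    have := abs_add_le (f 0) (f x - f 0)
    simpa using this
  rw [Real.norm_eq_abs, Real.norm_eq_abs]
  refine le_trans ?_ (le_abs_self _)
  have := mul_le_mul_of_nonneg_left h3 K.coe_nonneg
  linarith

lemma dist_update_update (x y : ι → ℝ) (i : ι) (t : ℝ) :
    dist (Function.update x i t) (Function.update y i t) ≤ dist x y := by
  refine (dist_pi_le_iff dist_nonneg).2 fun j => ?_
  by_cases h : j = i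
  · subst h; simp
  · simpa [h] using dist_le_pi_dist x y j

lemma LipschitzWith.update_slice {K : ℝ≥0} {f : (ι → ℝ) → ℝ}
    (hf : LipschitzWith K f) (x : ι → ℝ) (i : ι) :
    LipschitzWith K fun t => f (Function.update x i t) := by
  refine LipschitzWith.of_dist_le_mul fun s t => (hf.dist_le_mul _ _).trans ?_
  refine mul_le_mul_of_nonneg_left ?_ K.coe_nonneg
  refine (dist_pi_le_iff dist_nonneg).2 fun j => ?_
  by_cases h : j = i
  · subst h; simp
  · simp [h]

lemma LipschitzWith.comp_update {K : ℝ≥0} {f : (ι → ℝ) → ℝ}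
    (hf : LipschitzWith K f) (i : ι) (t : ℝ) :
    LipschitzWith K fun x => f (Function.update x i t) :=
  LipschitzWith.of_dist_le_mul fun x y => (hf.dist_le_mul _ _).trans
    (mul_le_mul_of_nonneg_left (dist_update_update x y i t) K.coe_nonneg)

omit [DecidableEq ι] [Fintype ι] in
lemma LipschitzWith.memLp_two_real {ν : Measure ℝ} [IsProbabilityMeasure ν] (hν : MemLp id 2 ν)
    {K : ℝ≥0} {f : ℝ → ℝ} (hf : LipschitzWith K f) : MemLp f 2 ν := by
  have h2a : MemLp (fun _ : ℝ => |f 0|) 2 ν := memLp_const _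
  have h2b : MemLp (fun x : ℝ => |x|) 2 ν := hν.norm
  have h2 : MemLp (fun x : ℝ => |f 0| + (K : ℝ) * |x|) 2 ν := h2a.add (h2b.const_mul (K : ℝ))
  refine h2.of_le hf.continuous.aestronglyMeasurable (ae_of_all _ fun x => ?_)
  have h4 := hf.dist_le_mul x 0
  rw [Real.dist_eq, Real.dist_eq, sub_zero] at h4
  have h5 : |f x| ≤ |f 0| + |f x - f 0| := by
    have := abs_add_le (f 0) (f x - f 0)
    simpa using this
  rw [Real.norm_eq_abs, Real.norm_eq_abs]
  exact le_trans (by linarith) (le_abs_self _)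

omit [Fintype ι] [DecidableEq ι] in
lemma integral_sub_sq {μ : Measure (ι → ℝ)} {f g : (ι → ℝ) → ℝ} (hf : MemLp f 2 μ)
    (hg : MemLp g 2 μ) : ∫ x, (f x - g x) ^ 2 ∂μ
      = ∫ x, (f x) ^ 2 ∂μ - 2 * ∫ x, f x * g x ∂μ + ∫ x, (g x) ^ 2 ∂μ := by
  have hfg : Integrable (fun x => 2 * (f x * g x)) μ := (MemLp.integrable_mul hf hg).const_mul 2
  have h1 : Integrable (fun x => (f x) ^ 2) μ := hf.integrable_sq
  have h2 : Integrable (fun x => (g x) ^ 2) μ := hg.integrable_sq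
  have h3 : Integrable (fun x => (f x) ^ 2 - 2 * (f x * g x)) μ := h1.sub hfg
  rw [← integral_const_mul, ← integral_sub h1 hfg, ← integral_add h3 h2]
  congr 1; ext x; ring

/-- The function obtained from `f` by averaging over the coordinate `i`. -/
noncomputable def coordAvg (i : ι) (f : (ι → ℝ) → ℝ) (x : ι → ℝ) : ℝ :=
  ∫ t, f (Function.update x i t) ∂ν

omit [Fintype ι] [IsProbabilityMeasure ν] in
lemma coordAvg_update (i : ι) (f : (ι → ℝ) → ℝ) (x : ι → ℝ) (t : ℝ) :
    coordAvg ν i f (Function.update x i t) = coordAvg ν i f x := by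
  simp [coordAvg]

lemma LipschitzWith.coordAvg {ν : Measure ℝ} [IsProbabilityMeasure ν] (hν : MemLp id 2 ν)
    {K : ℝ≥0} {f : (ι → ℝ) → ℝ} (hf : LipschitzWith K f) (i : ι) :
    LipschitzWith K (coordAvg ν i f) := by
  refine LipschitzWith.of_dist_le_mul fun x y => ?_
  have hi : ∀ x, Integrable (fun t => f (Function.update x i t)) ν := fun x =>
    ((hf.update_slice x i).memLp_two_real hν).integrable one_le_two
  simp only [_root_.coordAvg]
  rw [dist_eq_norm, ← integral_sub (hi x) (hi y)]
  have := norm_integral_le_of_norm_le_const (μ := ν) (C := K * dist x y)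
    (f := fun t => f (Function.update x i t) - f (Function.update y i t)) (ae_of_all _ fun t => by
      rw [← dist_eq_norm]
      exact (hf.dist_le_mul _ _).trans
        (mul_le_mul_of_nonneg_left (dist_update_update x y i t) K.coe_nonneg))
  simpa using this

lemma integral_coordAvg {f : (ι → ℝ) → ℝ} (hf : Integrable f (Measure.pi fun _ : ι => ν)) (i : ι) :
    ∫ x, coordAvg ν i f x ∂(Measure.pi fun _ : ι => ν) = ∫ x, f x ∂(Measure.pi fun _ : ι => ν) := by
  have h := measurePreserving_update_prod ν i
  conv_rhs => rw [← h.map_eq]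
  rw [integral_map h.measurable.aemeasurable (by rw [h.map_eq]; exact hf.1)]
  have hint := h.integrable_comp_of_integrable hf
  exact (integral_prod _ hint).symm

/-- Averaging over a coordinate is self-adjoint against functions that ignore the coordinate. -/
lemma integral_coordAvg_mul (hν : MemLp id 2 ν) {K K' : ℝ≥0} {f g : (ι → ℝ) → ℝ}
    (hf : LipschitzWith K f) (hg : LipschitzWith K' g) (i : ι)
    (hgi : ∀ x t, g (Function.update x i t) = g x) :
    ∫ x, coordAvg ν i f x * g x ∂(Measure.pi fun _ : ι => ν)
      = ∫ x, f x * g x ∂(Measure.pi fun _ : ι => ν) := by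
  have hfg : Integrable (fun x => f x * g x) (Measure.pi fun _ : ι => ν) :=
    MemLp.integrable_mul (hf.memLp_two_pi ν hν) (hg.memLp_two_pi ν hν)
  rw [← integral_coordAvg ν hfg i]
  congr 1
  ext x
  simp only [coordAvg, hgi, integral_mul_const]

/-- Among the functions that ignore the coordinate `i`, the average is the best approximation. -/
lemma integral_sq_sub_coordAvg_le (hν : MemLp id 2 ν) {K K' : ℝ≥0} {f g : (ι → ℝ) → ℝ}
    (hf : LipschitzWith K f) (hg : LipschitzWith K' g) (i : ι)
    (hgi : ∀ x t, g (Function.update x i t) = g x) :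
    ∫ x, (f x) ^ 2 ∂(Measure.pi fun _ : ι => ν)
        - ∫ x, (coordAvg ν i f x) ^ 2 ∂(Measure.pi fun _ : ι => ν)
      ≤ ∫ x, (f x - g x) ^ 2 ∂(Measure.pi fun _ : ι => ν) := by
  set μ := Measure.pi fun _ : ι => ν
  have ha := hf.coordAvg hν i
  have mf := hf.memLp_two_pi ν hν
  have mg := hg.memLp_two_pi ν hν
  have ma := ha.memLp_two_pi ν hν
  have e1 := integral_coordAvg_mul ν hν hf hg i hgi
  have hnn : 0 ≤ ∫ x, (coordAvg ν i f x - g x) ^ 2 ∂μ :=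
    integral_nonneg fun x => sq_nonneg _
  have x1 := integral_sub_sq ma mg
  have x2 := integral_sub_sq mf mg
  rw [x2]
  rw [x1, e1] at hnn
  linarith

lemma integral_coordAvg_sq_le (hν : MemLp id 2 ν) {K : ℝ≥0} {f : (ι → ℝ) → ℝ}
    (hf : LipschitzWith K f) (i : ι) :
    ∫ x, (coordAvg ν i f x) ^ 2 ∂(Measure.pi fun _ : ι => ν)
      ≤ ∫ x, (f x) ^ 2 ∂(Measure.pi fun _ : ι => ν) := by
  set μ := Measure.pi fun _ : ι => ν
  have ha := hf.coordAvg hν i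
  have mf := hf.memLp_two_pi ν hν
  have ma := ha.memLp_two_pi ν hν
  have e1 := integral_coordAvg_mul ν hν hf ha i (fun x t => coordAvg_update ν i f x t)
  have hnn : 0 ≤ ∫ x, (f x - coordAvg ν i f x) ^ 2 ∂μ :=
    integral_nonneg fun x => sq_nonneg _
  have x2 := integral_sub_sq mf ma
  have e2 : ∫ x, coordAvg ν i f x * coordAvg ν i f x ∂μ = ∫ x, (coordAvg ν i f x) ^ 2 ∂μ := by
    congr 1; ext x; ring
  rw [x2, ← e1, e2] at hnn
  linarith

lemma eq_of_forall_update_eq {g : (ι → ℝ) → ℝ}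
    (hg : ∀ i x t, g (Function.update x i t) = g x) (x y : ι → ℝ) : g x = g y := by
  have h : ∀ s : Finset ι, g (s.piecewise x y) = g y := fun s => by
    induction s using Finset.induction_on with
    | empty => simp
    | insert a s _ ih => rw [Finset.piecewise_insert, hg, ih]
  simpa using h Finset.univ

/-- **Efron–Stein inequality**: the variance of a Lipschitz function of independent variables is
at most the sum of its coordinatewise mean square oscillations. The coordinates are averaged out
one at a time. -/
theorem efronStein (hν : MemLp id 2 ν) {K : ℝ≥0} {f : (ι → ℝ) → ℝ} (hf : LipschitzWith K f) :
    ∫ x, (f x) ^ 2 ∂(Measure.pi fun _ : ι => ν) - (∫ x, f x ∂(Measure.pi fun _ : ι => ν)) ^ 2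
      ≤ ∑ i, ∫ x, (f x - f (Function.update x i 0)) ^ 2 ∂(Measure.pi fun _ : ι => ν) := by
  set μ := Measure.pi fun _ : ι => ν with hμ
  have main : ∀ s : Finset ι, ∃ g : (ι → ℝ) → ℝ, LipschitzWith K g ∧
      (∀ i ∈ s, ∀ x t, g (Function.update x i t) = g x) ∧ ∫ x, g x ∂μ = ∫ x, f x ∂μ ∧
      ∫ x, (f x) ^ 2 ∂μ - ∫ x, (g x) ^ 2 ∂μ
        ≤ ∑ i ∈ s, ∫ x, (f x - f (Function.update x i 0)) ^ 2 ∂μ ∧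
      ∀ i ∉ s, ∫ x, (g x - g (Function.update x i 0)) ^ 2 ∂μ
        ≤ ∫ x, (f x - f (Function.update x i 0)) ^ 2 ∂μ := by
    intro s
    induction s using Finset.induction_on with
    | empty => exact ⟨f, hf, by simp, rfl, by simp, fun _ _ => le_rfl⟩
    | insert a s has ih =>
      obtain ⟨g, hg, hgs, hgi, hgv, hgd⟩ := ih
      refine ⟨coordAvg ν a g, hg.coordAvg hν a, ?_, ?_, ?_, ?_⟩
      · intro i hi x t
        rcases Finset.mem_insert.1 hi with rfl | hi
        · exact coordAvg_update ν i g x t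
        · have hia : i ≠ a := fun h => has (h ▸ hi)
          simp only [coordAvg]
          congr 1; ext u
          rw [Function.update_comm hia, hgs i hi]
      · rw [integral_coordAvg ν ((hg.memLp_two_pi ν hν).integrable one_le_two), hgi]
      · rw [Finset.sum_insert has]
        have h1 := integral_sq_sub_coordAvg_le ν hν hg (hg.comp_update a 0) a
          (fun x t => by simp)
        have h2 := hgd a has
        linarith
      · intro i hi
        have hia : i ≠ a := fun h => hi (h ▸ Finset.mem_insert_self _ _)
        have his : i ∉ s := fun h => hi (Finset.mem_insert_of_mem h)
        refine le_trans ?_ (hgd i his)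
        refine le_trans (le_of_eq ?_) (integral_coordAvg_sq_le ν hν (hg.sub (hg.comp_update i 0)) a)
        congr 1; ext x
        congr 1
        simp only [coordAvg]
        rw [← integral_sub]
        · congr 1; ext t
          rw [Function.update_comm hia]
        · exact ((hg.update_slice x a).memLp_two_real hν).integrable one_le_two
        · exact ((hg.update_slice _ a).memLp_two_real hν).integrable one_le_two
  obtain ⟨g, hg, hgs, hgi, hgv, -⟩ := main Finset.univ
  have hc : ∀ x, g x = g 0 := fun x =>
    eq_of_forall_update_eq (fun i x t => hgs i (Finset.mem_univ i) x t) x 0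
  simp only [hc, integral_const, probReal_univ, smul_eq_mul, one_mul] at hgi hgv
  rw [← hgi]
  exact hgv

end EfronStein

/-! ### Minima of subset sums and their variance -/

/-- The properties of the edge weight distribution that the argument uses: it is a probability
measure on `[0, ∞)` whose distribution function is comparable to the identity near `0`, with an
exponential tail and a finite second moment. -/
structure IsEdgeLaw (ν : Measure ℝ) : Prop where
  isProb : IsProbabilityMeasure ν
  nonneg : ∀ᵐ t ∂ν, 0 ≤ t
  le : ∀ p, 0 ≤ p → ν.real (Iic p) ≤ p
  ge : ∀ p, 0 ≤ p → p ≤ 1 → p / 2 ≤ ν.real (Iic p)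
  tail : ∀ T, 1 ≤ T → ν.real (Ioi T) ≤ Real.exp (-T)
  memLp : MemLp id 2 ν

section MinSum

variable {E : Type*}

/-- The minimum over the index sets `B` in the family `𝓑` of the sum of the weights `x e`,
`e ∈ B`. -/
noncomputable def minSum (𝓑 : Finset (Finset E)) (h𝓑 : 𝓑.Nonempty) (x : E → ℝ) : ℝ :=
  𝓑.inf' h𝓑 fun B => ∑ e ∈ B, x e

lemma minSum_le {𝓑 : Finset (Finset E)} (h𝓑 : 𝓑.Nonempty) {B : Finset E} (hB : B ∈ 𝓑)
    (x : E → ℝ) : minSum 𝓑 h𝓑 x ≤ ∑ e ∈ B, x e :=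
  Finset.inf'_le (fun B => ∑ e ∈ B, x e) hB

lemma exists_minSum_eq {𝓑 : Finset (Finset E)} (h𝓑 : 𝓑.Nonempty) (x : E → ℝ) :
    ∃ B ∈ 𝓑, minSum 𝓑 h𝓑 x = ∑ e ∈ B, x e :=
  Finset.exists_mem_eq_inf' h𝓑 _

lemma sum_update_of_notMem [DecidableEq E] {B : Finset E} {i : E} (h : i ∉ B) (x : E → ℝ) (t : ℝ) :
    ∑ e ∈ B, Function.update x i t e = ∑ e ∈ B, x e :=
  Finset.sum_congr rfl fun _ he => Function.update_of_ne (ne_of_mem_of_not_mem he h) _ _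

lemma sum_update_of_mem' [DecidableEq E] {B : Finset E} {i : E} (h : i ∈ B) (x : E → ℝ) (t : ℝ) :
    ∑ e ∈ B, Function.update x i t e = ∑ e ∈ B, x e - x i + t := by
  rw [← Finset.add_sum_erase B _ h, ← Finset.add_sum_erase B _ h,
    sum_update_of_notMem (Finset.notMem_erase i B), Function.update_self]
  ring

/-- As a function of a single weight, `minSum` is everywhere supported from above by a line of
slope `0` or `1`. -/
lemma minSum_update_support [DecidableEq E] {𝓑 : Finset (Finset E)} (h𝓑 : 𝓑.Nonempty) (x : E → ℝ)
    (i : E) (t : ℝ) : ∃ c b : ℝ, (b = 0 ∨ b = 1) ∧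
      minSum 𝓑 h𝓑 (Function.update x i t) = c + b * t ∧
      ∀ s, minSum 𝓑 h𝓑 (Function.update x i s) ≤ c + b * s := by
  obtain ⟨B, hB, h⟩ := exists_minSum_eq h𝓑 (Function.update x i t)
  by_cases hi : i ∈ B
  · refine ⟨∑ e ∈ B, x e - x i, 1, Or.inr rfl, ?_, fun s => ?_⟩
    · rw [h, sum_update_of_mem' hi]; ring
    · refine (minSum_le h𝓑 hB _).trans (le_of_eq ?_)
      rw [sum_update_of_mem' hi]; ring
  · refine ⟨∑ e ∈ B, x e, 0, Or.inl rfl, ?_, fun s => ?_⟩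
    · rw [h, sum_update_of_notMem hi]; ring
    · refine (minSum_le h𝓑 hB _).trans (le_of_eq ?_)
      rw [sum_update_of_notMem hi]; ring

lemma sum_minSum_double_sub_le [Fintype E] [DecidableEq E] {𝓑 : Finset (Finset E)}
    (h𝓑 : 𝓑.Nonempty) (x : E → ℝ) :
    ∑ i, (minSum 𝓑 h𝓑 (Function.update x i (2 * x i)) - minSum 𝓑 h𝓑 x) ≤ minSum 𝓑 h𝓑 x := by
  obtain ⟨B, hB, h⟩ := exists_minSum_eq h𝓑 x
  have h1 : ∑ e ∈ B, x e = ∑ e, if e ∈ B then x e else 0 := by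
    rw [Finset.sum_ite_mem, Finset.univ_inter]
  conv_rhs => rw [h, h1]
  refine Finset.sum_le_sum fun i _ => ?_
  have h2 := minSum_le h𝓑 hB (Function.update x i (2 * x i))
  split_ifs with hi
  · rw [sum_update_of_mem' hi] at h2; linarith
  · rw [sum_update_of_notMem hi] at h2; linarith

lemma lipschitzWith_minSum [Fintype E] {𝓑 : Finset (Finset E)} (h𝓑 : 𝓑.Nonempty) :
    LipschitzWith (Fintype.card E) (minSum 𝓑 h𝓑) := by
  have key : ∀ x y, minSum 𝓑 h𝓑 x - minSum 𝓑 h𝓑 y ≤ Fintype.card E * dist x y := by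
    intro x y
    obtain ⟨B, hB, h⟩ := exists_minSum_eq h𝓑 y
    have h1 := minSum_le h𝓑 hB x
    have h2 : ∑ e ∈ B, x e - ∑ e ∈ B, y e ≤ ∑ e ∈ B, dist x y := by
      rw [← Finset.sum_sub_distrib]
      exact Finset.sum_le_sum fun e _ => (le_abs_self _).trans (dist_le_pi_dist x y e)
    rw [Finset.sum_const, nsmul_eq_mul] at h2
    have h3 : (B.card : ℝ) * dist x y ≤ Fintype.card E * dist x y :=
      mul_le_mul_of_nonneg_right (by exact_mod_cast Finset.card_le_univ B) dist_nonneg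
    linarith
  refine LipschitzWith.of_dist_le_mul fun x y => ?_
  rw [Real.dist_eq, abs_sub_le_iff]
  refine ⟨by simpa using key x y, ?_⟩
  rw [dist_comm]; simpa using key y x

end MinSum

section OneDim

/-- The function `g` is everywhere supported from above by a line of slope `0` or `1`. -/
def HasUnitSupports (g : ℝ → ℝ) : Prop :=
  ∀ t, ∃ c b : ℝ, (b = 0 ∨ b = 1) ∧ g t = c + b * t ∧ ∀ s, g s ≤ c + b * s

variable {g : ℝ → ℝ}

lemma HasUnitSupports.sub_nonneg (hg : HasUnitSupports g) {s t : ℝ} (h : s ≤ t) :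
    0 ≤ g t - g s ∧ g t - g s ≤ t - s := by
  obtain ⟨c, b, hb, h1, h2⟩ := hg s
  obtain ⟨c', b', hb', h1', h2'⟩ := hg t
  have := h2 t
  have := h2' s
  rcases hb with rfl | rfl <;> rcases hb' with rfl | rfl <;> constructor <;> linarith

lemma HasUnitSupports.lipschitzWith (hg : HasUnitSupports g) : LipschitzWith 1 g := by
  refine LipschitzWith.of_dist_le_mul fun s t => ?_
  rw [NNReal.coe_one, one_mul, Real.dist_eq, Real.dist_eq]
  rcases le_total s t with h | h
  · have := hg.sub_nonneg h
    rw [abs_sub_comm, abs_sub_comm s, abs_of_nonneg this.1, abs_of_nonneg (by linarith)]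
    exact this.2
  · have := hg.sub_nonneg h
    rw [abs_of_nonneg this.1, abs_of_nonneg (by linarith)]
    exact this.2

lemma HasUnitSupports.sub_zero_le (hg : HasUnitSupports g) {t : ℝ} (ht : 0 ≤ t) :
    g t - g 0 ≤ min 1 (g 1 - g 0) * (1 + t) := by
  obtain ⟨c, b, hb, h1, h2⟩ := hg 1
  have h01 := hg.sub_nonneg (zero_le_one' ℝ)
  have h0t := hg.sub_nonneg ht
  rw [min_eq_right (by linarith)]
  have a0 := h2 0
  have at' := h2 t
  rcases hb with rfl | rfl
  · nlinarith [mul_nonneg h01.1 ht]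
  · have : g 1 - g 0 = 1 := by linarith
    rw [this]; linarith

lemma HasUnitSupports.le_double_sub (hg : HasUnitSupports g) {t : ℝ} (ht : 0 ≤ t)
    (h : 2 * t < min 1 (g 1 - g 0)) : t ≤ g (2 * t) - g t := by
  obtain ⟨c, b, hb, h1, h2⟩ := hg (2 * t)
  have h0 := hg.sub_nonneg (mul_nonneg zero_le_two ht)
  have h3 := h2 1
  have h4 := h2 t
  have h5 := (lt_min_iff.1 h).2
  rcases hb with rfl | rfl
  · linarith
  · linarith

/-- The constant of the one-dimensional variance bound for the edge law `ν`. -/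
noncomputable def edgeLawConst (ν : Measure ℝ) : ℝ := 320 / 3 * ∫ t, (1 + |t|) ^ 2 ∂ν

lemma edgeLawConst_nonneg (ν : Measure ℝ) : 0 ≤ edgeLawConst ν :=
  mul_nonneg (by norm_num) (integral_nonneg fun t => sq_nonneg _)

lemma HasUnitSupports.integral_sq_le (hg : HasUnitSupports g) {ν : Measure ℝ} (hν : IsEdgeLaw ν) :
    ∫ t, (g t - g 0) ^ 2 ∂ν ≤ edgeLawConst ν * ∫ t, (g (2 * t) - g t) ∂ν := by
  have := hν.isProb
  set τ := min 1 (g 1 - g 0) with hτ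
  have hτ0 : 0 ≤ τ := le_min zero_le_one (hg.sub_nonneg (zero_le_one' ℝ)).1
  have hτ1 : τ ≤ 1 := min_le_left _ _
  have hm : MemLp (fun t : ℝ => 1 + |t|) 2 ν := (memLp_const (1 : ℝ)).add hν.memLp.norm
  have h1 : ∫ t, (g t - g 0) ^ 2 ∂ν ≤ τ ^ 2 * ∫ t, (1 + |t|) ^ 2 ∂ν := by
    rw [← integral_const_mul]
    refine integral_mono_of_nonneg (ae_of_all _ fun t => sq_nonneg _)
      (hm.integrable_sq.const_mul _) ?_
    filter_upwards [hν.nonneg] with t ht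
    rw [abs_of_nonneg ht, ← mul_pow]
    exact pow_le_pow_left₀ (hg.sub_nonneg ht).1 (hg.sub_zero_le ht) 2
  have hint : Integrable (fun t => g (2 * t) - g t) ν := by
    have i1 : LipschitzWith (1 * 2) fun t : ℝ => g (2 * t) :=
      hg.lipschitzWith.comp (LipschitzWith.of_dist_le_mul fun x y => by
        rw [Real.dist_eq, Real.dist_eq, ← mul_sub, abs_mul]; simp)
    exact ((i1.memLp_two_real hν.memLp).integrable one_le_two).sub
      ((hg.lipschitzWith.memLp_two_real hν.memLp).integrable one_le_two)
  have h2 : 3 / 320 * τ ^ 2 ≤ ∫ t, (g (2 * t) - g t) ∂ν := by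
    rcases hτ0.eq_or_lt with h0 | h0
    · rw [← h0]
      simp only [ne_eq, OfNat.ofNat_ne_zero, not_false_eq_true, zero_pow, mul_zero]
      refine integral_nonneg_of_ae ?_
      filter_upwards [hν.nonneg] with t ht
      exact (hg.sub_nonneg (by linarith)).1
    -- the interval is short enough for `le_double_sub`, and its endpoints are far enough apart
    -- for the factor `2` between the bounds on the distribution function
    · have h3 : ∫ t, (Ioc (τ / 8) (2 * τ / 5)).indicator (fun _ => τ / 8) t ∂ν
          ≤ ∫ t, (g (2 * t) - g t) ∂ν := by
        refine integral_mono_ae ((integrable_const _).indicator measurableSet_Ioc) hint ?_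
        filter_upwards [hν.nonneg] with t ht
        by_cases hmem : t ∈ Ioc (τ / 8) (2 * τ / 5)
        · rw [indicator_of_mem hmem]
          have := hg.le_double_sub ht (by rw [← hτ]; linarith [hmem.2])
          linarith [hmem.1]
        · rw [indicator_of_notMem hmem]
          exact (hg.sub_nonneg (by linarith)).1
      refine le_trans ?_ h3
      rw [integral_indicator measurableSet_Ioc, setIntegral_const, smul_eq_mul]
      have h4 : ν.real (Ioc (τ / 8) (2 * τ / 5))
          = ν.real (Iic (2 * τ / 5)) - ν.real (Iic (τ / 8)) := by
        rw [← Iic_sdiff_Iic, measureReal_sdiff (Iic_subset_Iic.2 (by linarith)) measurableSet_Iic]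
      have h5 := hν.le (τ / 8) (by linarith)
      have h6 := hν.ge (2 * τ / 5) (by linarith) (by linarith)
      rw [h4]
      nlinarith
  have h7 : 0 ≤ ∫ t, (1 + |t|) ^ 2 ∂ν := integral_nonneg fun t => sq_nonneg _
  rw [edgeLawConst]
  nlinarith [mul_le_mul_of_nonneg_left h2 h7]

end OneDim

section MinSumVariance

variable {E : Type*} [Fintype E] [DecidableEq E] {ν : Measure ℝ}

lemma integral_update_eq [IsProbabilityMeasure ν] {h : (E → ℝ) → ℝ}
    (hh : Integrable h (Measure.pi fun _ : E => ν)) (i : E) :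
    ∫ x, ∫ t, h (Function.update x i t) ∂ν ∂(Measure.pi fun _ : E => ν)
      = ∫ x, h x ∂(Measure.pi fun _ : E => ν) := integral_coordAvg ν hh i

omit [DecidableEq E] in
lemma IsEdgeLaw.ae_pi_nonneg (hν : IsEdgeLaw ν) :
    ∀ᵐ x ∂(Measure.pi fun _ : E => ν), ∀ e, 0 ≤ x e := by
  have := hν.isProb
  refine ae_all_iff.2 fun e => ?_
  exact (measurePreserving_eval (fun _ : E => ν) e).quasiMeasurePreserving.ae hν.nonneg

/-- The variance of a minimum of subset sums is at most a constant times its expectation. By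
the Efron–Stein inequality the variance is at most the sum of the contributions of the single
weights; the contribution of `x e` is controlled by the mean of the increase of the minimum when
`x e` is doubled, and these increases add up to at most the minimum itself. -/
theorem variance_minSum_le (hν : IsEdgeLaw ν) {𝓑 : Finset (Finset E)} (h𝓑 : 𝓑.Nonempty) :
    ∫ x, (minSum 𝓑 h𝓑 x) ^ 2 ∂(Measure.pi fun _ : E => ν)
        - (∫ x, minSum 𝓑 h𝓑 x ∂(Measure.pi fun _ : E => ν)) ^ 2
      ≤ edgeLawConst ν * ∫ x, minSum 𝓑 h𝓑 x ∂(Measure.pi fun _ : E => ν) := by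
  have := hν.isProb
  set μ := Measure.pi fun _ : E => ν with hμ
  set f := minSum 𝓑 h𝓑 with hf
  have hL := lipschitzWith_minSum h𝓑
  rw [← hf] at hL
  have hsup : ∀ x i, HasUnitSupports fun t => f (Function.update x i t) := fun x i t =>
    minSum_update_support h𝓑 x i t
  have hdL : ∀ i : E, LipschitzWith ((Fintype.card E) * 2) fun x : E → ℝ =>
      f (Function.update x i (2 * x i)) := fun i =>
    hL.comp (LipschitzWith.of_dist_le_mul fun x y => by
      refine (dist_pi_le_iff (by positivity)).2 fun j => ?_
      have hd := dist_le_pi_dist x y j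
      have hnn : 0 ≤ dist x y := dist_nonneg
      by_cases h : j = i
      · subst h
        simp only [Function.update_self]
        rw [Real.dist_eq, ← mul_sub, abs_mul, ← Real.dist_eq]
        simpa using hd
      · simp only [Function.update_of_ne h]
        simp only [NNReal.coe_ofNat]; linarith)
  have hfi := (hL.memLp_two_pi ν hν.memLp).integrable one_le_two
  have hdi : ∀ i, Integrable (fun x => f (Function.update x i (2 * x i)) - f x) μ := fun i =>
    (((hdL i).memLp_two_pi ν hν.memLp).integrable one_le_two).sub hfi
  have step : ∀ i, ∫ x, (f x - f (Function.update x i 0)) ^ 2 ∂μ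
      ≤ edgeLawConst ν * ∫ x, (f (Function.update x i (2 * x i)) - f x) ∂μ := by
    intro i
    have hsq : Integrable (fun x => (f x - f (Function.update x i 0)) ^ 2) μ :=
      ((hL.sub (hL.comp_update i 0)).memLp_two_pi ν hν.memLp).integrable_sq
    rw [← integral_update_eq hsq i, ← integral_update_eq (hdi i) i, ← integral_const_mul]
    have hmeas := measurePreserving_update_prod ν i
    refine integral_mono
      (hmeas.integrable_comp_of_integrable hsq).integral_prod_left
      ((hmeas.integrable_comp_of_integrable (hdi i)).integral_prod_left.const_mul _) fun x => ?_
    have h1 := (hsup x i).integral_sq_le hν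
    simpa using h1
  calc _ ≤ ∑ i, ∫ x, (f x - f (Function.update x i 0)) ^ 2 ∂μ := efronStein ν hν.memLp hL
    _ ≤ ∑ i, edgeLawConst ν * ∫ x, (f (Function.update x i (2 * x i)) - f x) ∂μ :=
        Finset.sum_le_sum fun i _ => step i
    _ = edgeLawConst ν * ∫ x, ∑ i, (f (Function.update x i (2 * x i)) - f x) ∂μ := by
        rw [integral_finsetSum _ fun i _ => hdi i, Finset.mul_sum]
    _ ≤ edgeLawConst ν * ∫ x, f x ∂μ := by
        refine mul_le_mul_of_nonneg_left ?_ (edgeLawConst_nonneg ν)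
        refine integral_mono_ae (integrable_finsetSum _ fun i _ => hdi i) hfi ?_
        exact ae_of_all _ fun x => sum_minSum_double_sub_le h𝓑 x

end MinSumVariance

/-! ### Copies of a graph in the complete graph and the greedy construction of factors -/

section Copies

variable {V : Type*} [Fintype V] (H : SimpleGraph V) {n : ℕ}

/-- An injection of the vertices of `H` into those of `K_n`, as a copy of `H` in `K_n`. -/
def knCopy (φ : V ↪ Fin n) : H.Copy (Kn n) :=
  ⟨⟨φ, fun h => φ.injective.ne h.ne⟩, φ.injective⟩

/-- The subgraph of `K_n` spanned by the copy `φ` of `H`. -/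
def copySubgraph (φ : V ↪ Fin n) : (Kn n).Subgraph := (knCopy H φ).toSubgraph

open Classical in
/-- The edges of the copy `φ` of `H`. -/
noncomputable def copyEdges (φ : V ↪ Fin n) : Finset (KnEdge n) :=
  Finset.univ.map (knCopy H φ).mapEdgeSet

lemma card_copyEdges (φ : V ↪ Fin n) : (copyEdges H φ).card = H.edgeSet.ncard := by
  classical
  rw [copyEdges, Finset.card_map, Finset.card_univ, ← Nat.card_coe_set_eq,
    Nat.card_eq_fintype_card]

omit [Fintype V] in
lemma verts_copySubgraph (φ : V ↪ Fin n) : (copySubgraph H φ).verts = Set.range φ := by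
  simp [copySubgraph, knCopy]

lemma mem_copyEdges {φ : V ↪ Fin n} {e : KnEdge n} :
    e ∈ copyEdges H φ ↔ (e : Sym2 (Fin n)) ∈ (copySubgraph H φ).edgeSet := by
  classical
  rw [copyEdges, copySubgraph, SimpleGraph.Copy.toSubgraph, SimpleGraph.Subgraph.edgeSet_map]
  simp only [Finset.mem_map, Finset.mem_univ, true_and, SimpleGraph.Subgraph.edgeSet_top,
    Set.mem_image]
  constructor
  · rintro ⟨a, rfl⟩
    exact ⟨a, a.2, rfl⟩
  · rintro ⟨a, ha, h⟩
    exact ⟨⟨a, ha⟩, Subtype.ext h⟩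

lemma exists_of_mem_copyEdges {φ : V ↪ Fin n} {e : KnEdge n} (he : e ∈ copyEdges H φ) :
    ∃ a ∈ H.edgeSet, Sym2.map φ a = e := by
  rw [mem_copyEdges, copySubgraph, SimpleGraph.Copy.toSubgraph,
    SimpleGraph.Subgraph.edgeSet_map] at he
  obtain ⟨a, ha, h⟩ := he
  exact ⟨a, by simpa using ha, h⟩

omit [Fintype V] in
lemma exists_copySubgraph_eq {G : (Kn n).Subgraph} (h : Nonempty (G.coe ≃g H)) :
    ∃ φ : V ↪ Fin n, copySubgraph H φ = G := by
  obtain ⟨e⟩ := h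
  obtain ⟨f, -, hf⟩ := SimpleGraph.Copy.toSubgraph_surjOn (A := H) (B := Kn n)
    (show G ∈ {B' : (Kn n).Subgraph | Nonempty (H ≃g B'.coe)} from ⟨e.symm⟩)
  exact ⟨f.toEmbedding, hf⟩

omit [Fintype V] in
lemma nonempty_iso_copySubgraph (φ : V ↪ Fin n) : Nonempty ((copySubgraph H φ).coe ≃g H) :=
  ⟨(knCopy H φ).isoToSubgraph.symm⟩

open Classical in
/-- The edges of `K_n` that belong to some member of the collection `Q`. -/
noncomputable def collectionEdges (Q : Finset (Kn n).Subgraph) : Finset (KnEdge n) :=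
  Finset.univ.filter fun e => ∃ G ∈ Q, (e : Sym2 (Fin n)) ∈ G.edgeSet

lemma eq_of_mem_edgeSet {Q : Finset (Kn n).Subgraph}
    (hQ : ∀ G ∈ Q, ∀ G' ∈ Q, G ≠ G' → Disjoint G.verts G'.verts) {G G' : (Kn n).Subgraph}
    (hG : G ∈ Q) (hG' : G' ∈ Q) {e : Sym2 (Fin n)} (h : e ∈ G.edgeSet) (h' : e ∈ G'.edgeSet) :
    G = G' := by
  by_contra hne
  induction e with | _ a b =>
  exact Set.disjoint_left.1 (hQ G hG G' hG' hne) (G.edge_vert h) (G'.edge_vert h')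

lemma totalWeight_eq_sum {Q : Finset (Kn n).Subgraph}
    (hQ : ∀ G ∈ Q, ∀ G' ∈ Q, G ≠ G' → Disjoint G.verts G'.verts) (x : KnEdge n → ℝ) :
    totalWeight x Q = ∑ e ∈ collectionEdges Q, x e := by
  classical
  rw [totalWeight, Finset.sum_comm, collectionEdges, Finset.sum_filter]
  refine Finset.sum_congr rfl fun e _ => ?_
  split_ifs with h
  · obtain ⟨G, hG, he⟩ := h
    rw [Finset.sum_eq_single_of_mem G hG, if_pos he]
    intro G' hG' hne
    rw [if_neg fun he' => hne (eq_of_mem_edgeSet hQ hG' hG he' he)]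
  · refine Finset.sum_eq_zero fun G hG => ?_
    rw [if_neg fun he => h ⟨G, hG, he⟩]

/-- The edge sets of the `(α, H)`-factors of `K_n`. -/
noncomputable def factorEdgeSets (n : ℕ) (α : ℝ) : Finset (Finset (KnEdge n)) :=
  (Set.toFinite {B | ∃ Q, IsPartialFactor H n α Q ∧ collectionEdges Q = B}).toFinset

omit [Fintype V] in
lemma minFactorWeight_eq_minSum {k : ℝ} (h : (factorEdgeSets H n (k / n)).Nonempty)
    (x : KnEdge n → ℝ) : minFactorWeight H k n x = minSum (factorEdgeSets H n (k / n)) h x := by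
  rw [minFactorWeight, minSum, Finset.inf'_eq_csInf_image]
  congr 1
  ext y
  simp only [Set.mem_image, factorEdgeSets, Set.Finite.coe_toFinset]
  constructor
  · rintro ⟨Q, hQ, rfl⟩
    exact ⟨_, ⟨Q, hQ, rfl⟩, (totalWeight_eq_sum hQ.disjoint x).symm⟩
  · rintro ⟨_, ⟨Q, hQ, rfl⟩, rfl⟩
    exact ⟨Q, hQ, totalWeight_eq_sum hQ.disjoint x⟩

omit [Fintype V] in
lemma IsPartialFactor.mono {H : SimpleGraph V} {α β : ℝ} (hαβ : α ≤ β) {Q : Finset (Kn n).Subgraph}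
    (h : IsPartialFactor H n α Q) : IsPartialFactor H n β Q :=
  ⟨h.iso, h.disjoint, le_trans (by gcongr) h.cover⟩

omit [Fintype V] in
lemma minFactorWeight_le_totalWeight {k : ℝ} {x : KnEdge n → ℝ} {Q : Finset (Kn n).Subgraph}
    (hQ : IsPartialFactor H n (k / n) Q) : minFactorWeight H k n x ≤ totalWeight x Q := by
  have hmem : collectionEdges Q ∈ factorEdgeSets H n (k / n) := by
    simp only [factorEdgeSets, Set.Finite.mem_toFinset]
    exact ⟨Q, hQ, rfl⟩
  rw [minFactorWeight_eq_minSum H ⟨_, hmem⟩, totalWeight_eq_sum hQ.disjoint]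
  exact minSum_le _ hmem x

/-- The greedy construction: if every nonempty vertex set `S` whose size is a multiple of `v_H`
contains a copy of `H` with all weights at most `r |S|`, then removing such copies one at a time
produces a collection that covers a given set exactly. -/
lemma exists_greedy_cover [Nonempty V] {x : KnEdge n → ℝ} {r : ℕ → ℝ} (hr : ∀ j, 0 ≤ r j)
    (hS : ∀ S : Finset (Fin n), S.Nonempty → Fintype.card V ∣ S.card →
      ∃ φ : V ↪ Fin n, (∀ v, φ v ∈ S) ∧ ∀ e ∈ copyEdges H φ, x e ≤ r S.card) :
    ∀ (m : ℕ) (S : Finset (Fin n)), S.card = m → Fintype.card V ∣ m →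
      ∃ Q : Finset (Kn n).Subgraph, (∀ G ∈ Q, Nonempty (G.coe ≃g H)) ∧
        (∀ G ∈ Q, ∀ G' ∈ Q, G ≠ G' → Disjoint G.verts G'.verts) ∧
        (⋃ G ∈ Q, G.verts) = (S : Set (Fin n)) ∧
        totalWeight x Q ≤ H.edgeSet.ncard * ∑ j ∈ Finset.Icc 1 m, r j := by
  classical
  intro m
  induction m using Nat.strong_induction_on with
  | _ m ih =>
  intro S hSm hdvd
  rcases S.eq_empty_or_nonempty with rfl | hne
  · exact ⟨∅, by simp, by simp, by simp, by
      simp only [totalWeight, Finset.sum_empty]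
      exact mul_nonneg (Nat.cast_nonneg _) (Finset.sum_nonneg fun j _ => hr j)⟩
  obtain ⟨φ, hφ, hle⟩ := hS S hne (hSm ▸ hdvd)
  have hsub : Finset.univ.map φ ⊆ S := fun a ha => by
    obtain ⟨v, -, rfl⟩ := Finset.mem_map.1 ha
    exact hφ v
  have hcard : (S \ Finset.univ.map φ).card = m - Fintype.card V := by
    rw [Finset.card_sdiff_of_subset hsub, Finset.card_map, Finset.card_univ, hSm]
  have hV : 0 < Fintype.card V := Fintype.card_pos
  have hm : 0 < m := hSm ▸ hne.card_pos
  obtain ⟨Q, h1, h2, h3, h4⟩ := ih (m - Fintype.card V) (by omega) _ hcard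
    (Nat.dvd_sub hdvd dvd_rfl)
  have hdisj : ∀ G ∈ Q, Disjoint (copySubgraph H φ).verts G.verts := by
    intro G hG
    rw [verts_copySubgraph]
    refine Set.disjoint_left.2 ?_
    rintro _ ⟨v, rfl⟩ hv
    have : φ v ∈ (⋃ G ∈ Q, G.verts) := Set.mem_biUnion hG hv
    rw [h3] at this
    simp at this
  have hnot : copySubgraph H φ ∉ Q := by
    intro hmem
    have := hdisj _ hmem
    rw [disjoint_self, verts_copySubgraph] at this
    exact (Set.range_nonempty φ).ne_empty this
  refine ⟨insert (copySubgraph H φ) Q, ?_, ?_, ?_, ?_⟩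
  · intro G hG
    rcases Finset.mem_insert.1 hG with rfl | hG
    · exact nonempty_iso_copySubgraph H φ
    · exact h1 G hG
  · intro G hG G' hG' hne'
    rcases Finset.mem_insert.1 hG with rfl | hG <;> rcases Finset.mem_insert.1 hG' with rfl | hG'
    · exact absurd rfl hne'
    · exact hdisj _ hG'
    · exact (hdisj _ hG).symm
    · exact h2 G hG G' hG' hne'
  · rw [Finset.set_biUnion_insert, h3, verts_copySubgraph]
    ext a
    simp only [Set.mem_union, Set.mem_range, Finset.coe_sdiff, Set.mem_sdiff, Finset.mem_coe,
      Finset.mem_map, Finset.mem_univ, true_and]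
    constructor
    · rintro (⟨v, rfl⟩ | h)
      · exact hφ v
      · exact h.1
    · intro h
      by_cases h' : ∃ v, φ v = a
      · exact Or.inl h'
      · exact Or.inr ⟨h, h'⟩
  · have hw : (∑ e : KnEdge n, if (e : Sym2 (Fin n)) ∈ (copySubgraph H φ).edgeSet then x e else 0)
        ≤ H.edgeSet.ncard * r m := by
      simp only [← mem_copyEdges]
      rw [Finset.sum_ite_mem, Finset.univ_inter, ← card_copyEdges H φ, ← nsmul_eq_mul]
      refine Finset.sum_le_card_nsmul _ _ _ fun e he => ?_
      rw [← hSm]; exact hle e he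
    have hins : totalWeight x (insert (copySubgraph H φ) Q)
        = (∑ e : KnEdge n, if (e : Sym2 (Fin n)) ∈ (copySubgraph H φ).edgeSet then x e else 0)
          + totalWeight x Q := by
      rw [totalWeight, Finset.sum_insert hnot, totalWeight]
    have hsum : r m + ∑ j ∈ Finset.Icc 1 (m - Fintype.card V), r j ≤ ∑ j ∈ Finset.Icc 1 m, r j := by
      rw [← Finset.sum_insert (f := r) (a := m) (by simp; omega)]
      refine Finset.sum_le_sum_of_subset_of_nonneg (fun j hj => ?_) fun j _ _ => hr j
      rw [Finset.mem_insert, Finset.mem_Icc] at hj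
      rw [Finset.mem_Icc]
      omega
    rw [hins]
    have := mul_le_mul_of_nonneg_left hsum (Nat.cast_nonneg (α := ℝ) H.edgeSet.ncard)
    linarith

lemma minFactorWeight_le_of_greedy [Nonempty V] {x : KnEdge n → ℝ} {r : ℕ → ℝ} (hr : ∀ j, 0 ≤ r j)
    (hS : ∀ S : Finset (Fin n), S.Nonempty → Fintype.card V ∣ S.card →
      ∃ φ : V ↪ Fin n, (∀ v, φ v ∈ S) ∧ ∀ e ∈ copyEdges H φ, x e ≤ r S.card)
    (hn : Fintype.card V ∣ n) {k : ℝ} (hk : 0 ≤ k) :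
    minFactorWeight H k n x ≤ H.edgeSet.ncard * ∑ j ∈ Finset.Icc 1 n, r j := by
  obtain ⟨Q, h1, h2, h3, h4⟩ := exists_greedy_cover H hr hS n Finset.univ (by simp) hn
  refine (minFactorWeight_le_totalWeight H (IsPartialFactor.mono (α := 0) (by positivity)
    ⟨h1, h2, ?_⟩)).trans h4
  rw [h3]; simp [Set.ncard_univ]

lemma exists_embedding_mem (S : Finset (Fin n)) (h : Fintype.card V ≤ S.card) :
    ∃ φ : V ↪ Fin n, ∀ v, φ v ∈ S := by
  obtain ⟨f⟩ := Function.Embedding.nonempty_of_card_le (α := V) (β := S) (by simpa using h)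
  exact ⟨f.trans (Function.Embedding.subtype _), fun v => (f v).2⟩

lemma factorEdgeSets_nonempty [Nonempty V] (hn : Fintype.card V ∣ n) {k : ℝ} (hk : 0 ≤ k) :
    (factorEdgeSets H n (k / n)).Nonempty := by
  obtain ⟨Q, h1, h2, h3, -⟩ := exists_greedy_cover (n := n) H (x := 0) (r := 0) (fun _ => le_rfl)
    (fun S hS hd => by
      obtain ⟨φ, hφ⟩ := exists_embedding_mem S (Nat.le_of_dvd hS.card_pos hd)
      exact ⟨φ, hφ, fun _ _ => le_rfl⟩) n Finset.univ (by simp) hn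
  refine ⟨collectionEdges Q, ?_⟩
  simp only [factorEdgeSets, Set.Finite.mem_toFinset]
  refine ⟨Q, IsPartialFactor.mono (α := 0) (by positivity) ⟨h1, h2, ?_⟩, rfl⟩
  rw [h3]; simp [Set.ncard_univ]

end Copies

/-! ### The maximum `1`-density -/

section Density

variable {V : Type*} [Finite V] (H : SimpleGraph V)

omit [Finite V] in
lemma ncard_edgeSet_coe (G : H.Subgraph) : G.coe.edgeSet.ncard = G.edgeSet.ncard := by
  rw [← G.image_coe_edgeSet_coe]
  exact (Set.ncard_image_of_injective _ (Sym2.map.injective Subtype.val_injective)).symm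

lemma exists_subgraph_density_eq : ∃ G : H.Subgraph,
    (G.edgeSet.ncard : ℝ) / ((G.verts.ncard : ℝ) - 1) = maxDensity H :=
  exists_eq_ciSup_of_finite

lemma density_le_maxDensity (G : H.Subgraph) :
    (G.edgeSet.ncard : ℝ) / ((G.verts.ncard : ℝ) - 1) ≤ maxDensity H :=
  le_ciSup (f := fun G : H.Subgraph => (G.edgeSet.ncard : ℝ) / ((G.verts.ncard : ℝ) - 1))
    (Set.finite_range _).bddAbove G

lemma two_le_ncard_verts (G : H.Subgraph) (h : G.edgeSet.Nonempty) : 2 ≤ G.verts.ncard := by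
  obtain ⟨e, he⟩ := h
  induction e with | _ a b =>
  have hab : a ≠ b := G.adj_sub he |>.ne
  rw [← Set.ncard_pair hab]
  refine Set.ncard_le_ncard ?_ (Set.toFinite _)
  rintro x (rfl | rfl)
  · exact G.edge_vert he
  · exact G.edge_vert (G.adj_symm he)

/-- Every nonempty set `F` of edges of `H` satisfies `|F| ≤ d^* (|W| - 1)`, where `W` is a vertex
set that contains the endpoints of all members of `F`. -/
lemma ncard_le_maxDensity_mul {F : Set (Sym2 V)} (hF : F ⊆ H.edgeSet) (hne : F.Nonempty)
    (W : Set V) (hW : ∀ e ∈ F, ∀ a ∈ e, a ∈ W) :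
    (F.ncard : ℝ) ≤ maxDensity H * ((W.ncard : ℝ) - 1) := by
  let G : H.Subgraph :=
    { verts := W
      Adj := fun a b => s(a, b) ∈ F
      adj_sub := fun h => hF h
      edge_vert := fun h => hW _ h _ (Sym2.mem_mk_left _ _)
      symm := ⟨fun a b h => by rwa [Sym2.eq_swap]⟩ }
  have hG : G.edgeSet = F := by
    ext e
    induction e with | _ a b => exact Iff.rfl
  have h2 : 2 ≤ W.ncard := two_le_ncard_verts H G (hG ▸ hne)
  have h := density_le_maxDensity H G
  rw [hG] at h
  have h2' : (2 : ℝ) ≤ W.ncard := by exact_mod_cast h2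
  exact (div_le_iff₀ (by linarith)).1 h

lemma ncard_edgeSet_le_of_isAcyclic (h : H.IsAcyclic) (G : H.Subgraph) (hG : G.verts.Nonempty) :
    G.edgeSet.ncard + 1 ≤ G.verts.ncard := by
  classical
  have := Fintype.ofFinite V
  have : Nonempty G.verts := hG.to_subtype
  obtain ⟨T, hT, -, hTree⟩ := SimpleGraph.Connected.exists_isTree_le_of_le_of_isAcyclic
    (SimpleGraph.connected_top (V := G.verts)) le_top (h.subgraph G)
  have h1 := hTree.card_edgeFinset
  have h2 : G.coe.edgeSet.ncard ≤ T.edgeFinset.card := by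
    rw [← Set.ncard_coe_finset, SimpleGraph.coe_edgeFinset]
    exact Set.ncard_le_ncard (SimpleGraph.edgeSet_mono hT) (Set.toFinite _)
  rw [ncard_edgeSet_coe] at h2
  have h3 : Fintype.card G.verts = G.verts.ncard := by
    rw [← Nat.card_coe_set_eq, Nat.card_eq_fintype_card]
  omega

theorem one_lt_maxDensity_iff : 1 < maxDensity H ↔ ¬ H.IsAcyclic := by
  classical
  constructor
  · intro h hac
    obtain ⟨G, hG⟩ := exists_subgraph_density_eq H
    rw [← hG] at h
    rcases G.verts.eq_empty_or_nonempty with h0 | h0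
    · rw [h0] at h
      have : (G.edgeSet.ncard : ℝ) / (((∅ : Set V).ncard : ℝ) - 1) ≤ 0 :=
        div_nonpos_of_nonneg_of_nonpos (Nat.cast_nonneg _) (by simp)
      linarith
    · have h1 : ((G.edgeSet.ncard + 1 : ℕ) : ℝ) ≤ G.verts.ncard := by
        exact_mod_cast ncard_edgeSet_le_of_isAcyclic H hac G h0
      push_cast at h1
      have := div_le_one_of_le₀ (a := (G.edgeSet.ncard : ℝ)) (b := (G.verts.ncard : ℝ) - 1)
        (by linarith) (by have : (0 : ℝ) ≤ G.edgeSet.ncard := Nat.cast_nonneg _; linarith)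
      linarith
  · intro h
    rw [SimpleGraph.IsAcyclic] at h
    push Not at h
    obtain ⟨u, c, hc⟩ := h
    refine lt_of_lt_of_le ?_ (density_le_maxDensity H c.toSubgraph)
    have hlen := hc.three_le_length
    have he : c.toSubgraph.edgeSet.ncard = c.length := by
      have : c.toSubgraph.edgeSet = (c.edges.toFinset : Set (Sym2 V)) := by
        ext e; simp
      rw [this, Set.ncard_coe_finset, List.toFinset_card_of_nodup hc.edges_nodup,
        SimpleGraph.Walk.length_edges]
    have hv : c.toSubgraph.verts.ncard ≤ c.length := by
      have : c.toSubgraph.verts ⊆ (c.support.tail.toFinset : Set V) := by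
        intro w hw
        rw [SimpleGraph.Walk.mem_verts_toSubgraph] at hw
        rw [Finset.mem_coe, List.mem_toFinset]
        rw [← c.cons_tail_support] at hw
        rcases List.mem_cons.1 hw with rfl | hw
        · exact c.end_mem_tail_support hc.not_nil
        · exact hw
      refine (Set.ncard_le_ncard this (Set.toFinite _)).trans ?_
      rw [Set.ncard_coe_finset]
      refine (List.toFinset_card_le _).trans ?_
      simp
    have h2 : 2 ≤ c.toSubgraph.verts.ncard := two_le_ncard_verts H _ (by
      rw [← Set.ncard_pos (Set.toFinite _), he]; omega)
    rw [he, one_lt_div]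
    · have : (c.toSubgraph.verts.ncard : ℝ) ≤ c.length := by exact_mod_cast hv
      linarith
    · have : (2 : ℝ) ≤ c.toSubgraph.verts.ncard := by exact_mod_cast h2
      linarith

/-- A densest subgraph: its edges number exactly `d^*` times the number of its vertices minus
one. -/
lemma exists_densest_subgraph (h : 0 < maxDensity H) : ∃ G : H.Subgraph,
    2 ≤ G.verts.ncard ∧ 1 ≤ G.edgeSet.ncard ∧
      (G.edgeSet.ncard : ℝ) = maxDensity H * ((G.verts.ncard : ℝ) - 1) := by
  obtain ⟨G, hG⟩ := exists_subgraph_density_eq H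
  have hne : G.edgeSet.Nonempty := by
    by_contra hcon
    rw [Set.not_nonempty_iff_eq_empty] at hcon
    rw [hcon] at hG
    simp at hG
    linarith
  have h2 := two_le_ncard_verts H G hne
  refine ⟨G, h2, (Set.ncard_pos (Set.toFinite _)).2 hne, ?_⟩
  have h2' : (2 : ℝ) ≤ G.verts.ncard := by exact_mod_cast h2
  rw [← hG, div_mul_cancel₀]
  linarith

end Density

/-! ### The probability that a vertex set contains no light copy -/

section NoCopy

variable {V : Type*} [Fintype V] (H : SimpleGraph V) {n : ℕ}

/-- The edges shared by two copies of `H` span, inside the second copy, a subgraph on the common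
vertices, so that their number is controlled by the maximum `1`-density. -/
lemma card_inter_copyEdges_le (φ ψ : V ↪ Fin n)
    [DecidableEq (KnEdge n)] (h : (copyEdges H φ ∩ copyEdges H ψ).Nonempty) :
    ((copyEdges H φ ∩ copyEdges H ψ).card : ℝ)
      ≤ maxDensity H * (({w | ψ w ∈ Set.range φ} : Set V).ncard - 1) := by
  classical
  let ι : H.edgeSet ↪ KnEdge n := (knCopy H ψ).mapEdgeSet
  let F' : Set H.edgeSet := {a | ι a ∈ copyEdges H φ}
  let F : Set (Sym2 V) := Subtype.val '' F'
  have hcard : (copyEdges H φ ∩ copyEdges H ψ).card = F.ncard := by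
    rw [Set.ncard_image_of_injective _ Subtype.val_injective,
      ← Set.ncard_image_of_injective F' ι.injective, ← Set.ncard_coe_finset]
    congr 1
    ext e
    simp only [Finset.coe_inter, Set.mem_inter_iff, Finset.mem_coe, Set.mem_image, F']
    constructor
    · rintro ⟨h1, h2⟩
      obtain ⟨a, -, rfl⟩ := Finset.mem_map.1 h2
      exact ⟨a, h1, rfl⟩
    · rintro ⟨a, h1, rfl⟩
      exact ⟨h1, Finset.mem_map_of_mem _ (Finset.mem_univ a)⟩
  rw [hcard]
  refine ncard_le_maxDensity_mul H ?_ ?_ _ ?_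
  · rintro _ ⟨a, -, rfl⟩; exact a.2
  · rw [← Set.ncard_pos (Set.toFinite _), ← hcard]
    exact Finset.card_pos.2 h
  · rintro _ ⟨a, ha, rfl⟩ w hw
    obtain ⟨b, -, hb⟩ := exists_of_mem_copyEdges H ha
    have h1 : ψ w ∈ Sym2.map φ b := by
      rw [hb]
      exact Sym2.mem_map.2 ⟨w, hw, rfl⟩
    obtain ⟨u, -, hu⟩ := Sym2.mem_map.1 h1
    exact ⟨u, hu⟩

/-- The sum over the copies `ψ` in `S` of `m ^ j`, where `j` is the number of vertices that `ψ`
shares with a fixed copy `φ`, is bounded by expanding a product over the vertices of `H`. -/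
lemma sum_pow_common_le (φ : V ↪ Fin n) (S : Finset (Fin n)) {m : ℝ} (hm : 1 ≤ m)
    (hS : (S.card : ℝ) ≤ m) [Fintype {ψ : V ↪ Fin n // ∀ v, ψ v ∈ S}] :
    ∑ ψ : {ψ : V ↪ Fin n // ∀ v, ψ v ∈ S}, m ^ ({w | ψ.1 w ∈ Set.range φ} : Set V).ncard
      ≤ ((Fintype.card V + 1) * m) ^ Fintype.card V := by
  classical
  let g : Fin n → ℝ := fun a => if a ∈ Set.range φ then m else 1
  have hg : ∀ a, 0 ≤ g a := fun a => by dsimp [g]; split_ifs <;> linarith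
  have h1 : ∀ ψ : V ↪ Fin n, m ^ ({w | ψ w ∈ Set.range φ} : Set V).ncard = ∏ w, g (ψ w) := by
    intro ψ
    rw [Finset.prod_ite, Finset.prod_const, Finset.prod_const_one, mul_one,
      ← Set.ncard_coe_finset]
    congr 2
    ext w; simp
  have h2 : ∑ ψ : {ψ : V ↪ Fin n // ∀ v, ψ v ∈ S}, ∏ w, g (ψ.1 w)
      ≤ ∑ f ∈ Fintype.piFinset fun _ : V => S, ∏ w, g (f w) := by
    have hinj : Function.Injective
        fun (ψ : {ψ : V ↪ Fin n // ∀ v, ψ v ∈ S}) (w : V) => ψ.1 w := fun ψ ψ' h =>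
      Subtype.ext (DFunLike.coe_injective h)
    rw [← Finset.sum_image (s := Finset.univ) (f := fun f : V → Fin n => ∏ w, g (f w))
      (g := fun (ψ : {ψ : V ↪ Fin n // ∀ v, ψ v ∈ S}) (w : V) => ψ.1 w) hinj.injOn]
    refine Finset.sum_le_sum_of_subset_of_nonneg (fun f hf => ?_)
      fun f _ _ => Finset.prod_nonneg fun w _ => hg _
    obtain ⟨ψ, -, rfl⟩ := Finset.mem_image.1 hf
    exact Fintype.mem_piFinset.2 ψ.2
  simp only [h1]
  refine h2.trans ?_
  rw [← Finset.prod_univ_sum (fun _ : V => S) (fun _ a => g a), Finset.prod_const,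
    Finset.card_univ]
  refine pow_le_pow_left₀ (Finset.sum_nonneg fun a _ => hg a) ?_ _
  have h3 : ∀ a, g a ≤ 1 + if a ∈ Finset.univ.map φ then m else 0 := fun a => by
    have : a ∈ Finset.univ.map φ ↔ a ∈ Set.range φ := by simp
    simp only [this, g]
    split_ifs <;> linarith
  calc ∑ a ∈ S, g a ≤ ∑ a ∈ S, (1 + if a ∈ Finset.univ.map φ then m else 0) :=
        Finset.sum_le_sum fun a _ => h3 a
    _ = S.card + (S ∩ Finset.univ.map φ).card * m := by
        rw [Finset.sum_add_distrib, Finset.sum_ite_mem]; simp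
    _ ≤ m + Fintype.card V * m := by
        refine add_le_add hS (mul_le_mul_of_nonneg_right ?_ (by linarith))
        have := Finset.card_le_card (Finset.inter_subset_right (s₁ := S) (s₂ := Finset.univ.map φ))
        rw [Finset.card_map, Finset.card_univ] at this
        exact_mod_cast this
    _ = _ := by ring

/-- The constant in the exponential bound for the probability that a vertex set contains no light
copy of a graph on `v` vertices. -/
noncomputable def noCopyConst (v : ℕ) : ℝ := 1 / (2 * (2 * ((v : ℝ) + 1)) ^ v)

lemma noCopyConst_pos (v : ℕ) : 0 < noCopyConst v := by unfold noCopyConst; positivity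

lemma card_embeddings_ge (S : Finset (Fin n)) (h : 2 * Fintype.card V ≤ S.card)
    [Fintype {ψ : V ↪ Fin n // ∀ v, ψ v ∈ S}] :
    ((S.card : ℝ) / 2) ^ Fintype.card V ≤ Fintype.card {ψ : V ↪ Fin n // ∀ v, ψ v ∈ S} := by
  classical
  have h1 : Fintype.card (V ↪ S) ≤ Fintype.card {ψ : V ↪ Fin n // ∀ v, ψ v ∈ S} :=
    Fintype.card_le_of_injective
      (fun f => ⟨f.trans (Function.Embedding.subtype _), fun v => (f v).2⟩) fun f f' hff => by
        ext v
        exact congrArg (fun g : {ψ : V ↪ Fin n // ∀ v, ψ v ∈ S} => ((g.1 v : Fin n) : ℕ)) hff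
  rw [Fintype.card_embedding_eq, Fintype.card_coe] at h1
  have h2 := Nat.pow_sub_le_descFactorial S.card (Fintype.card V)
  have h3 : ((S.card + 1 - Fintype.card V : ℕ) : ℝ) ^ Fintype.card V
      ≤ Fintype.card {ψ : V ↪ Fin n // ∀ v, ψ v ∈ S} := by exact_mod_cast h2.trans h1
  refine le_trans (pow_le_pow_left₀ (by positivity) ?_ _) h3
  rw [Nat.cast_sub (by omega)]
  have : (2 : ℝ) * Fintype.card V ≤ S.card := by exact_mod_cast h
  push_cast; linarith

/-- If the probability `q` that a weight is at most `p` is at least `C' m^{-1/d^*}`, then a set of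
`m` vertices contains no copy of `H` with all weights at most `p` with probability at most
`exp (-c C' m)`. -/
theorem prob_no_light_copy_le {ν : Measure ℝ} [IsProbabilityMeasure ν] (hd : 0 < maxDensity H)
    (S : Finset (Fin n)) (hS : 2 * Fintype.card V ≤ S.card) (hS1 : 1 ≤ S.card) {p q C' : ℝ}
    (hq : ν.real (Iic p) = q) (hC' : 1 ≤ C')
    (hqC : C' ≤ q * (S.card : ℝ) ^ (1 / maxDensity H)) :
    (Measure.pi fun _ : KnEdge n => ν).real
      {x | ∀ φ : V ↪ Fin n, (∀ v, φ v ∈ S) → ∃ e ∈ copyEdges H φ, p < x e}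
      ≤ Real.exp (-(noCopyConst (Fintype.card V) * C' * S.card)) := by
  classical
  set m : ℝ := (S.card : ℝ) with hm
  have hm1 : 1 ≤ m := by rw [hm]; exact_mod_cast hS1
  have hm0 : 0 < m := by linarith
  set d := maxDensity H with hdd
  set v := Fintype.card V with hv
  set eH := H.edgeSet.ncard with heH
  have hmd : 1 ≤ m ^ (1 / d) := Real.one_le_rpow hm1 (by positivity)
  have hq0 : 0 < q := by
    by_contra hcon
    push Not at hcon
    have : q * m ^ (1 / d) ≤ 0 := mul_nonpos_of_nonpos_of_nonneg hcon (by positivity)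
    linarith
  let I := {ψ : V ↪ Fin n // ∀ v, ψ v ∈ S}
  let A : I → Finset (KnEdge n) := fun ψ => copyEdges H ψ.1
  set N : ℝ := (Fintype.card I : ℝ) with hN
  set B : ℝ := q ^ (2 * eH) * ((v + 1) * m) ^ v / (C' * m) with hB
  have hB0 : 0 < B := by positivity
  have hpair : ∀ φ ψ : I, (A φ ∩ A ψ).Nonempty → q ^ (A φ ∪ A ψ).card
      ≤ q ^ (2 * eH) / (C' * m) * m ^ ({w | ψ.1 w ∈ Set.range φ.1} : Set V).ncard := by
    intro φ ψ hne
    set f := (A φ ∩ A ψ).card with hf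
    set W := ({w | ψ.1 w ∈ Set.range φ.1} : Set V).ncard with hW
    have hf1 : 1 ≤ f := Finset.card_pos.2 hne
    have hfW : (f : ℝ) ≤ d * (W - 1) := card_inter_copyEdges_le H φ.1 ψ.1 hne
    have hcard : (A φ ∪ A ψ).card + f = 2 * eH := by
      rw [hf, Finset.card_union_add_card_inter, card_copyEdges, card_copyEdges]; ring
    have h1 : C' * m ≤ q ^ f * m ^ W := by
      have h2 : C' ^ f ≤ q ^ f * (m ^ (1 / d)) ^ f := by
        rw [← mul_pow]; exact pow_le_pow_left₀ (by linarith) hqC f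
      have h3 : C' ≤ C' ^ f := le_self_pow₀ hC' (by omega)
      have h4 : (m ^ (1 / d)) ^ f * m ≤ m ^ W := by
        rw [← Real.rpow_natCast, ← Real.rpow_mul hm0.le, ← Real.rpow_natCast m W]
        nth_rewrite 2 [← Real.rpow_one m]
        rw [← Real.rpow_add hm0]
        refine Real.rpow_le_rpow_of_exponent_le hm1 ?_
        rw [one_div, inv_mul_eq_div]
        have : (f : ℝ) / d ≤ W - 1 := (div_le_iff₀' hd).2 hfW
        linarith
      calc C' * m ≤ q ^ f * (m ^ (1 / d)) ^ f * m :=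
            mul_le_mul_of_nonneg_right (h3.trans h2) hm0.le
        _ = q ^ f * ((m ^ (1 / d)) ^ f * m) := by ring
        _ ≤ q ^ f * m ^ W := mul_le_mul_of_nonneg_left h4 (by positivity)
    rw [div_mul_eq_mul_div, le_div_iff₀ (by positivity), ← hcard, pow_add, mul_assoc]
    exact mul_le_mul_of_nonneg_left h1 (by positivity)
  have hDelta : ∑ φ : I, ∑ ψ : I, (if (A φ ∩ A ψ).Nonempty then q ^ (A φ ∪ A ψ).card else 0)
      ≤ N * B := by
    rw [hN, ← nsmul_eq_mul, ← Finset.card_univ]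
    refine Finset.sum_le_card_nsmul _ _ _ fun φ _ => ?_
    calc ∑ ψ : I, (if (A φ ∩ A ψ).Nonempty then q ^ (A φ ∪ A ψ).card else 0)
        ≤ ∑ ψ : I, q ^ (2 * eH) / (C' * m) * m ^ ({w | ψ.1 w ∈ Set.range φ.1} : Set V).ncard := by
          refine Finset.sum_le_sum fun ψ _ => ?_
          split_ifs with h
          · exact hpair φ ψ h
          · positivity
      _ ≤ q ^ (2 * eH) / (C' * m) * ((v + 1) * m) ^ v := by
          rw [← Finset.mul_sum]
          exact mul_le_mul_of_nonneg_left (sum_pow_common_le φ.1 S hm1 le_rfl) (by positivity)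
      _ = B := by rw [hB]; ring
  have hmean : ∑ φ : I, q ^ (A φ).card = N * q ^ eH := by
    simp only [A, card_copyEdges]
    rw [Finset.sum_const, nsmul_eq_mul, Finset.card_univ]
  have hNge : (m / 2) ^ v ≤ N := card_embeddings_ge S hS
  have hset : {x : KnEdge n → ℝ | ∀ φ : V ↪ Fin n, (∀ v, φ v ∈ S) → ∃ e ∈ copyEdges H φ, p < x e}
      = {x | ∀ φ : I, ∃ e ∈ A φ, p < x e} := by
    ext x
    exact ⟨fun h φ => h φ.1 φ.2, fun h φ hφ => h ⟨φ, hφ⟩⟩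
  rw [hset]
  -- this `s` minimizes the bound on the exponent
  refine (janson_pi ν A hq hq0 (s := q ^ eH / B) (by positivity)).trans ?_
  rw [Real.exp_le_exp, hmean]
  have e1 : (q ^ eH / B) ^ 2 / 2 * (N * B) = N * q ^ (2 * eH) / (2 * B) := by
    rw [two_mul, pow_add]; field_simp
  have e2 : q ^ eH / B * (N * q ^ eH) = 2 * (N * q ^ (2 * eH) / (2 * B)) := by
    rw [two_mul eH, pow_add]; field_simp
  have e3 : N * q ^ (2 * eH) / (2 * B) = N * (C' * m) / (2 * ((v + 1) * m) ^ v) := by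
    rw [hB]; field_simp
  have e4 : noCopyConst v * C' * m = (m / 2) ^ v * (C' * m) / (2 * ((v + 1) * m) ^ v) := by
    rw [noCopyConst, mul_pow, mul_pow, div_pow]; field_simp
  have h5 : noCopyConst v * C' * m ≤ N * q ^ (2 * eH) / (2 * B) := by
    rw [e3, e4]; gcongr
  have h6 := mul_le_mul_of_nonneg_left hDelta (show 0 ≤ (q ^ eH / B) ^ 2 / 2 by positivity)
  rw [e1] at h6
  rw [e2]
  linarith

end NoCopy

/-! ### The upper tail -/

section UpperTail

lemma sum_rpow_neg_le {s : ℝ} (h0 : 0 < s) (h1 : s < 1) (n : ℕ) :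
    ∑ j ∈ Finset.Icc 1 n, (j : ℝ) ^ (-s) ≤ (n : ℝ) ^ (1 - s) / (1 - s) := by
  induction n with
  | zero => simp; positivity
  | succ n ih =>
    rw [Finset.sum_Icc_succ_top (by omega)]
    have hn : (0 : ℝ) < ((n + 1 : ℕ) : ℝ) := by positivity
    have hb := rpow_one_add_le_one_add_mul_self (s := -(1 / ((n + 1 : ℕ) : ℝ)))
      (by rw [neg_le_neg_iff, div_le_one hn]; push_cast; linarith [Nat.cast_nonneg (α := ℝ) n])
      (p := 1 - s) (by linarith) (by linarith)
    have e1 : (n : ℝ) ^ (1 - s)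
        = ((n + 1 : ℕ) : ℝ) ^ (1 - s) * (1 + -(1 / ((n + 1 : ℕ) : ℝ))) ^ (1 - s) := by
      rw [← Real.mul_rpow hn.le]
      · congr 1; field_simp; push_cast; ring
      · have : 1 / ((n + 1 : ℕ) : ℝ) ≤ 1 := by
          rw [div_le_one hn]; push_cast; linarith [Nat.cast_nonneg (α := ℝ) n]
        linarith
    have e2 : ((n + 1 : ℕ) : ℝ) ^ (-s) = ((n + 1 : ℕ) : ℝ) ^ (1 - s) / ((n + 1 : ℕ) : ℝ) := by
      rw [← Real.rpow_sub_one hn.ne']; congr 1; ring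
    have h3 := mul_le_mul_of_nonneg_left hb (Real.rpow_nonneg hn.le (1 - s))
    rw [← e1] at h3
    have hs : 0 < 1 - s := by linarith
    refine (add_le_add_left ih _).trans ?_
    rw [e2, le_div_iff₀ hs, add_mul, div_mul_cancel₀ _ hs.ne']
    refine (add_le_add_left h3 _).trans (le_of_eq ?_)
    ring

lemma eventually_mul_exp_neg_le (A : ℝ) {c ε : ℝ} (hc : 0 < c) (hε : 0 < ε) (K : ℝ) :
    ∀ᶠ n : ℕ in atTop, A * (n : ℝ) ^ 2 * Real.exp (-(c * (n : ℝ) ^ ε)) ≤ (n : ℝ) ^ (-K) := by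
  have h1 := isLittleO_exp_neg_mul_rpow_atTop hc (-(K + 3) / ε)
  have h2 : Tendsto (fun n : ℕ => (n : ℝ) ^ ε) atTop atTop :=
    (tendsto_rpow_atTop hε).comp tendsto_natCast_atTop_atTop
  have h3 := (h1.comp_tendsto h2).bound (show (0 : ℝ) < 1 by norm_num)
  filter_upwards [h3, eventually_ge_atTop 1, tendsto_natCast_atTop_atTop.eventually_ge_atTop |A|]
    with n hn hn1 hnA
  have hn0 : (0 : ℝ) < n := by exact_mod_cast hn1
  simp only [Function.comp, Real.norm_eq_abs, Real.abs_exp, one_mul] at hn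
  rw [← Real.rpow_mul hn0.le, mul_div_cancel₀ _ hε.ne', abs_of_pos (Real.rpow_pos_of_pos hn0 _),
    neg_mul] at hn
  calc A * (n : ℝ) ^ 2 * Real.exp (-(c * (n : ℝ) ^ ε))
      ≤ n * (n : ℝ) ^ 2 * (n : ℝ) ^ (-(K + 3)) := by
        refine mul_le_mul ?_ hn (Real.exp_pos _).le (by positivity)
        exact mul_le_mul_of_nonneg_right ((le_abs_self A).trans hnA) (by positivity)
    _ = (n : ℝ) ^ (-K) := by
        have : (n : ℝ) * (n : ℝ) ^ 2 = (n : ℝ) ^ (3 : ℝ) := by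
          rw [← pow_succ']; norm_cast
        rw [this, ← Real.rpow_add hn0]; congr 1; ring

lemma choose_le_exp {n j : ℕ} (hj : 1 ≤ j) (hjn : j ≤ n) :
    (n.choose j : ℝ) ≤ Real.exp (j * (1 + Real.log (n / j))) := by
  have hj0 : (0 : ℝ) < j := by exact_mod_cast hj
  have hn0 : (0 : ℝ) < n := by exact_mod_cast hj.trans hjn
  have h1 : (n.choose j : ℝ) ≤ (n : ℝ) ^ j / j.factorial := Nat.choose_le_pow_div j n
  have h2 := Real.pow_div_factorial_le_exp _ hj0.le j
  have h3 : Real.exp (j * (1 + Real.log (n / j))) = Real.exp j * ((n : ℝ) / j) ^ j := by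
    rw [mul_add, mul_one, Real.exp_add, Real.exp_nat_mul, Real.exp_log (by positivity)]
  rw [h3]
  refine h1.trans ?_
  calc (n : ℝ) ^ j / j.factorial = (j : ℝ) ^ j / j.factorial * ((n : ℝ) / j) ^ j := by
        rw [div_pow]; field_simp
    _ ≤ _ := mul_le_mul_of_nonneg_right h2 (by positivity)

variable {V : Type*} [Fintype V] (H : SimpleGraph V) {n : ℕ} {ν : Measure ℝ}

lemma prob_exists_set_no_light_copy_le [IsProbabilityMeasure ν] (hd : 0 < maxDensity H)
    {j : ℕ} (hj : 2 * Fintype.card V ≤ j) (hj1 : 1 ≤ j) (hjn : j ≤ n) {p C' : ℝ} (hC' : 1 ≤ C')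
    (hqC : C' ≤ ν.real (Iic p) * (j : ℝ) ^ (1 / maxDensity H))
    (hlog : 2 + Real.log (n / j) ≤ noCopyConst (Fintype.card V) * C') :
    (Measure.pi fun _ : KnEdge n => ν).real
      {x | ∃ S : Finset (Fin n), S.card = j ∧
        ∀ φ : V ↪ Fin n, (∀ v, φ v ∈ S) → ∃ e ∈ copyEdges H φ, p < x e} ≤ Real.exp (-j) := by
  have hset : {x : KnEdge n → ℝ | ∃ S : Finset (Fin n), S.card = j ∧
        ∀ φ : V ↪ Fin n, (∀ v, φ v ∈ S) → ∃ e ∈ copyEdges H φ, p < x e}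
      = ⋃ S ∈ Finset.powersetCard j (Finset.univ : Finset (Fin n)),
        {x | ∀ φ : V ↪ Fin n, (∀ v, φ v ∈ S) → ∃ e ∈ copyEdges H φ, p < x e} := by
    ext x; simp
  rw [hset]
  refine (measureReal_biUnion_finset_le _ _).trans ?_
  have h1 : ∀ S ∈ Finset.powersetCard j (Finset.univ : Finset (Fin n)),
      (Measure.pi fun _ : KnEdge n => ν).real
        {x | ∀ φ : V ↪ Fin n, (∀ v, φ v ∈ S) → ∃ e ∈ copyEdges H φ, p < x e}
      ≤ Real.exp (-(noCopyConst (Fintype.card V) * C' * j)) := by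
    intro S hS
    have hSj := (Finset.mem_powersetCard.1 hS).2
    have := prob_no_light_copy_le H (ν := ν) hd S (hSj ▸ hj) (hSj ▸ hj1) (p := p) rfl hC'
      (by rw [hSj]; exact hqC)
    rwa [hSj] at this
  refine (Finset.sum_le_card_nsmul _ _ _ h1).trans ?_
  rw [Finset.card_powersetCard, Finset.card_univ, Fintype.card_fin, nsmul_eq_mul]
  refine (mul_le_mul_of_nonneg_right (choose_le_exp hj1 hjn) (Real.exp_pos _).le).trans ?_
  rw [← Real.exp_add, Real.exp_le_exp]
  nlinarith [mul_le_mul_of_nonneg_right hlog (Nat.cast_nonneg (α := ℝ) j)]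

lemma card_knEdge_le (n : ℕ) : (Fintype.card (KnEdge n) : ℝ) ≤ (n : ℝ) ^ 2 := by
  classical
  have h1 : Fintype.card (KnEdge n) = n.choose 2 := by
    have := SimpleGraph.card_edgeFinset_top_eq_card_choose_two (V := Fin n)
    rw [Fintype.card_fin, SimpleGraph.edgeFinset_card] at this
    rw [← this]
  rw [h1]
  exact_mod_cast Nat.choose_le_pow n 2

lemma prob_exists_weight_gt_le (hν : IsEdgeLaw ν) {T : ℝ} (hT : 1 ≤ T) :
    (Measure.pi fun _ : KnEdge n => ν).real {x | ∃ e, T < x e} ≤ (n : ℝ) ^ 2 * Real.exp (-T) := by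
  have := hν.isProb
  have hset : {x : KnEdge n → ℝ | ∃ e, T < x e}
      = ⋃ e ∈ (Finset.univ : Finset (KnEdge n)), {x | T < x e} := by
    ext x; simp
  rw [hset]
  refine (measureReal_biUnion_finset_le _ _).trans ?_
  have h1 : ∀ e ∈ (Finset.univ : Finset (KnEdge n)),
      (Measure.pi fun _ : KnEdge n => ν).real {x | T < x e} ≤ Real.exp (-T) := by
    intro e _
    have := (measurePreserving_eval (fun _ : KnEdge n => ν) e).measureReal_preimage
      (s := Ioi T) measurableSet_Ioi.nullMeasurableSet
    exact this.le.trans (hν.tail T hT)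
  refine (Finset.sum_le_card_nsmul _ _ _ h1).trans ?_
  rw [Finset.card_univ, nsmul_eq_mul]
  exact mul_le_mul_of_nonneg_right (card_knEdge_le n) (Real.exp_pos _).le

lemma sum_greedy_bound_le {ε δ d C : ℝ} (hd : 1 < d) (hε : ε = (1 - 1 / d) / 2)
    (hδ0 : 0 < δ) (hδ : δ + 1 / d < 1) (hC : 0 ≤ C) (hn : 1 ≤ n) :
    ∑ j ∈ Finset.Icc 1 n, (if (n : ℝ) ^ ε ≤ j then 2 * C * ((n : ℝ) / j) ^ δ * (j : ℝ) ^ (-(1 / d))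
      else (n : ℝ) ^ ε) ≤ (1 + 2 * C / (1 - (δ + 1 / d))) * (n : ℝ) ^ (1 - 1 / d) := by
  have hn0 : (0 : ℝ) < n := by exact_mod_cast hn
  have hd0 : 0 < 1 / d := by positivity
  have h1 : ∀ j ∈ Finset.Icc 1 n, (if (n : ℝ) ^ ε ≤ j then
      2 * C * ((n : ℝ) / j) ^ δ * (j : ℝ) ^ (-(1 / d)) else (n : ℝ) ^ ε)
      ≤ 2 * C * (n : ℝ) ^ δ * (j : ℝ) ^ (-(δ + 1 / d))
        + if (j : ℝ) < (n : ℝ) ^ ε then (n : ℝ) ^ ε else 0 := by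
    intro j hj
    have hj0 : (0 : ℝ) < j := by exact_mod_cast (Finset.mem_Icc.1 hj).1
    have hnn : 0 ≤ 2 * C * (n : ℝ) ^ δ * (j : ℝ) ^ (-(δ + 1 / d)) := by positivity
    by_cases h : (n : ℝ) ^ ε ≤ j
    · rw [if_pos h, if_neg (not_lt.2 h), add_zero, Real.div_rpow hn0.le hj0.le, neg_add,
        Real.rpow_add hj0, Real.rpow_neg hj0.le δ]
      exact le_of_eq (by ring)
    · rw [if_neg h, if_pos (not_le.1 h)]; linarith
  refine (Finset.sum_le_sum h1).trans ?_
  rw [Finset.sum_add_distrib, ← Finset.mul_sum, ← Finset.sum_filter, Finset.sum_const,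
    nsmul_eq_mul]
  have h2 : (((Finset.Icc 1 n).filter fun j : ℕ => (j : ℝ) < (n : ℝ) ^ ε).card : ℝ)
      ≤ (n : ℝ) ^ ε := by
    have hsub : ((Finset.Icc 1 n).filter fun j : ℕ => (j : ℝ) < (n : ℝ) ^ ε)
        ⊆ Finset.Icc 1 ⌊(n : ℝ) ^ ε⌋₊ := by
      intro j hj
      rw [Finset.mem_filter, Finset.mem_Icc] at hj
      exact Finset.mem_Icc.2 ⟨hj.1.1, Nat.le_floor hj.2.le⟩
    have := Finset.card_le_card hsub
    rw [Nat.card_Icc, Nat.add_sub_cancel] at this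
    exact (Nat.cast_le.2 this).trans (Nat.floor_le (by positivity))
  have h3 : (n : ℝ) ^ ε * (n : ℝ) ^ ε = (n : ℝ) ^ (1 - 1 / d) := by
    rw [← Real.rpow_add hn0, hε]; congr 1; ring
  have h4 := sum_rpow_neg_le (s := δ + 1 / d) (by linarith) hδ n
  have h5 : (n : ℝ) ^ δ * (n : ℝ) ^ (1 - (δ + 1 / d)) = (n : ℝ) ^ (1 - 1 / d) := by
    rw [← Real.rpow_add hn0]; congr 1; ring
  calc _ ≤ 2 * C * (n : ℝ) ^ δ * ((n : ℝ) ^ (1 - (δ + 1 / d)) / (1 - (δ + 1 / d)))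
        + (n : ℝ) ^ ε * (n : ℝ) ^ ε := by gcongr
    _ = 2 * C * ((n : ℝ) ^ δ * (n : ℝ) ^ (1 - (δ + 1 / d))) / (1 - (δ + 1 / d))
        + (n : ℝ) ^ ε * (n : ℝ) ^ ε := by ring
    _ = _ := by rw [h3, h5]; ring

/-- The upper tail: with very high probability the greedy construction, in which a copy is chosen
among `j` remaining vertices with weights at most of order `(n / j) ^ δ j ^ (-1/d^*)`, produces a
factor of weight `O(n ^ (1 - 1/d^*))`. The factor `(n / j) ^ δ` pays for the union bound over the
possible sets of remaining vertices; the last `n ^ ε` vertices are covered at arbitrary cost. -/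
theorem upper_tail (hν : IsEdgeLaw ν) (hd : 1 < maxDensity H) [Nonempty V] :
    ∃ b : ℝ, 0 < b ∧ ∀ K : ℝ, ∀ᶠ n : ℕ in atTop, Fintype.card V ∣ n → ∀ k : ℝ, 0 ≤ k →
      (Measure.pi fun _ : KnEdge n => ν).real
        {x | ¬ minFactorWeight H k n x ≤ b * (n : ℝ) ^ (1 - 1 / maxDensity H)}
        ≤ (n : ℝ) ^ (-K) := by
  have := hν.isProb
  set d := maxDensity H with hdd
  set v := Fintype.card V with hv
  have hd0 : 0 < d := by linarith
  have hd1 : 1 / d < 1 := (div_lt_one hd0).2 hd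
  have hdi : 0 < 1 / d := by positivity
  set ε := (1 - 1 / d) / 2 with hε
  have hε0 : 0 < ε := by rw [hε]; linarith
  -- `δ < ε / d` makes the weight bounds tend to `0` as long as `n ^ ε` vertices remain
  set δ := ε * (1 / d) / 2 with hδ
  have hδ0 : 0 < δ := by positivity
  have hδε : δ < ε := by rw [hδ]; nlinarith
  have hs : δ + 1 / d < 1 := by linarith
  set c := noCopyConst v with hc
  have hc0 : 0 < c := noCopyConst_pos v
  -- the constant for which `c C x ^ δ ≥ 2 + log x` when `x ≥ 1`
  set C := max 1 ((2 + 1 / δ) / c) with hC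
  have hC1 : 1 ≤ C := le_max_left _ _
  have hCc : 2 + 1 / δ ≤ c * C := by
    have : (2 + 1 / δ) / c ≤ C := le_max_right _ _
    rwa [div_le_iff₀' hc0] at this
  have hlog : ∀ x : ℝ, 1 ≤ x → 2 + Real.log x ≤ c * (C * x ^ δ) := by
    intro x hx
    have h1 := Real.log_le_rpow_div (by linarith : 0 ≤ x) hδ0
    have h2 := Real.one_le_rpow hx hδ0.le
    calc 2 + Real.log x ≤ 2 * x ^ δ + x ^ δ / δ := by linarith
      _ = (2 + 1 / δ) * x ^ δ := by ring
      _ ≤ c * C * x ^ δ := mul_le_mul_of_nonneg_right hCc (by linarith)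
      _ = _ := by ring
  set b := H.edgeSet.ncard * (1 + 2 * C / (1 - (δ + 1 / d))) + 1 with hb
  have hb1 : 0 ≤ 1 + 2 * C / (1 - (δ + 1 / d)) := by
    have : 0 < 1 - (δ + 1 / d) := by linarith
    positivity
  refine ⟨b, by positivity, fun K => ?_⟩
  have hε_tend : Tendsto (fun n : ℕ => (n : ℝ) ^ ε) atTop atTop :=
    (tendsto_rpow_atTop hε0).comp tendsto_natCast_atTop_atTop
  have hδ_tend : Tendsto (fun n : ℕ => (n : ℝ) ^ δ) atTop atTop :=
    (tendsto_rpow_atTop hδ0).comp tendsto_natCast_atTop_atTop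
  filter_upwards [eventually_mul_exp_neg_le 2 one_pos hε0 K, eventually_ge_atTop 1,
    hε_tend.eventually_ge_atTop (2 * v + 1), hδ_tend.eventually_ge_atTop (2 * C)]
    with n hK hn1 hnε hnδ hdvd k hk
  have hn0 : (0 : ℝ) < n := by exact_mod_cast hn1
  have hn1' : (1 : ℝ) ≤ n := by exact_mod_cast hn1
  refine le_trans ?_ hK
  set μ := Measure.pi fun _ : KnEdge n => ν with hμ
  let p : ℕ → ℝ := fun j => 2 * C * ((n : ℝ) / j) ^ δ * (j : ℝ) ^ (-(1 / d))
  let r : ℕ → ℝ := fun j => if (n : ℝ) ^ ε ≤ j then p j else (n : ℝ) ^ ε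
  let bad : ℕ → Set (KnEdge n → ℝ) := fun j => {x | ∃ S : Finset (Fin n), S.card = j ∧
        ∀ φ : V ↪ Fin n, (∀ v, φ v ∈ S) → ∃ e ∈ copyEdges H φ, p j < x e}
  have hr : ∀ j, 0 ≤ r j := fun j => by dsimp only [r, p]; split_ifs <;> positivity
  have hbad : ∀ j ∈ (Finset.Icc 1 n).filter (fun j : ℕ => (n : ℝ) ^ ε ≤ j),
      μ.real (bad j) ≤ Real.exp (-(1 * (n : ℝ) ^ ε)) := by
    intro j hj
    rw [Finset.mem_filter, Finset.mem_Icc] at hj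
    obtain ⟨⟨hj1, hjn⟩, hjε⟩ := hj
    have hj0 : (0 : ℝ) < j := by exact_mod_cast hj1
    have hnj : (1 : ℝ) ≤ n / j := (one_le_div hj0).2 (by exact_mod_cast hjn)
    have hnjδ := Real.one_le_rpow hnj hδ0.le
    have hp0 : 0 ≤ p j := by dsimp only [p]; positivity
    have hp1 : p j ≤ 1 := by
      have h1 : ((n : ℝ) / j) ^ δ ≤ (n : ℝ) ^ δ :=
        Real.rpow_le_rpow (by positivity) (div_le_self hn0.le (by exact_mod_cast hj1)) hδ0.le
      have h2 : (j : ℝ) ^ (-(1 / d)) ≤ ((n : ℝ) ^ ε) ^ (-(1 / d)) :=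
        Real.rpow_le_rpow_of_nonpos (by positivity) hjε (by linarith)
      have h3 : (n : ℝ) ^ δ * ((n : ℝ) ^ ε) ^ (-(1 / d)) = ((n : ℝ) ^ δ)⁻¹ := by
        rw [← Real.rpow_mul hn0.le, ← Real.rpow_add hn0, ← Real.rpow_neg hn0.le]
        congr 1; rw [hδ]; ring
      calc p j ≤ 2 * C * (n : ℝ) ^ δ * ((n : ℝ) ^ ε) ^ (-(1 / d)) := by
            dsimp only [p]; gcongr
        _ = 2 * C * ((n : ℝ) ^ δ)⁻¹ := by rw [mul_assoc, h3]
        _ ≤ (n : ℝ) ^ δ * ((n : ℝ) ^ δ)⁻¹ := by gcongr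
        _ = 1 := mul_inv_cancel₀ (by positivity)
    have hq := hν.ge (p j) hp0 hp1
    have h2v : 2 * v ≤ j := by
      have : (2 * v : ℝ) ≤ j := by linarith
      exact_mod_cast this
    refine (prob_exists_set_no_light_copy_le H hd0 h2v hj1 hjn (C' := C * ((n : ℝ) / j) ^ δ)
      ?_ ?_ (hlog _ hnj)).trans ?_
    · nlinarith
    · calc C * ((n : ℝ) / j) ^ δ = p j / 2 * (j : ℝ) ^ (1 / d) := by
            dsimp only [p]
            rw [Real.rpow_neg hj0.le]
            field_simp
        _ ≤ _ := mul_le_mul_of_nonneg_right hq (by positivity)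
    · rw [Real.exp_le_exp]; linarith
  have hincl : {x | ¬ minFactorWeight H k n x ≤ b * (n : ℝ) ^ (1 - 1 / d)}
      ⊆ {x | ∃ e, (n : ℝ) ^ ε < x e} ∪
        ⋃ j ∈ (Finset.Icc 1 n).filter (fun j : ℕ => (n : ℝ) ^ ε ≤ j), bad j := by
    intro x hx
    by_contra hcon
    simp only [mem_union, mem_ofPred_eq, mem_iUnion, not_or, not_exists, not_lt] at hcon
    obtain ⟨hT, hB⟩ := hcon
    refine hx ?_
    refine (minFactorWeight_le_of_greedy H hr (fun S hSne hSd => ?_) hdvd hk).trans ?_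
    · by_cases h : (n : ℝ) ^ ε ≤ S.card
      · have hmem : S.card ∈ (Finset.Icc 1 n).filter (fun j : ℕ => (n : ℝ) ^ ε ≤ j) := by
          rw [Finset.mem_filter, Finset.mem_Icc]
          exact ⟨⟨hSne.card_pos, by simpa using Finset.card_le_univ S⟩, h⟩
        have := hB _ hmem
        simp only [bad, mem_ofPred_eq, not_exists, not_and, not_forall] at this
        obtain ⟨φ, hφ, hle⟩ := this S rfl
        refine ⟨φ, hφ, fun e he => ?_⟩
        simp only [r, if_pos h]
        exact not_lt.1 (hle e he)
      · obtain ⟨φ, hφ⟩ := exists_embedding_mem S (Nat.le_of_dvd hSne.card_pos hSd)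
        refine ⟨φ, hφ, fun e _ => ?_⟩
        simp only [r, if_neg h]
        exact hT e
    · have h1 := sum_greedy_bound_le (n := n) hd hε hδ0 hs (by linarith : 0 ≤ C) hn1
      have h2 := mul_le_mul_of_nonneg_left h1 (Nat.cast_nonneg (α := ℝ) H.edgeSet.ncard)
      refine h2.trans ?_
      rw [← mul_assoc]
      exact mul_le_mul_of_nonneg_right (by rw [hb]; linarith) (by positivity)
  have hcardle : (((Finset.Icc 1 n).filter (fun j : ℕ => (n : ℝ) ^ ε ≤ j)).card : ℝ) ≤ n := by
    have := Finset.card_filter_le (Finset.Icc 1 n) (fun j : ℕ => (n : ℝ) ^ ε ≤ j)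
    rw [Nat.card_Icc, Nat.add_sub_cancel] at this
    exact_mod_cast this
  calc μ.real {x | ¬ minFactorWeight H k n x ≤ b * (n : ℝ) ^ (1 - 1 / d)}
      ≤ μ.real {x | ∃ e, (n : ℝ) ^ ε < x e} +
        μ.real (⋃ j ∈ (Finset.Icc 1 n).filter (fun j : ℕ => (n : ℝ) ^ ε ≤ j), bad j) :=
        (measureReal_mono hincl).trans (measureReal_union_le _ _)
    _ ≤ (n : ℝ) ^ 2 * Real.exp (-(n : ℝ) ^ ε) + n * Real.exp (-(1 * (n : ℝ) ^ ε)) := by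
        refine add_le_add (prob_exists_weight_gt_le hν ?_) ?_
        · have : (0 : ℝ) ≤ v := Nat.cast_nonneg v
          linarith
        · refine (measureReal_biUnion_finset_le _ _).trans ?_
          refine (Finset.sum_le_card_nsmul _ _ _ hbad).trans ?_
          rw [nsmul_eq_mul]
          exact mul_le_mul_of_nonneg_right hcardle (Real.exp_pos _).le
    _ ≤ 2 * (n : ℝ) ^ 2 * Real.exp (-(1 * (n : ℝ) ^ ε)) := by
        rw [one_mul]
        have hn2 : (n : ℝ) ≤ (n : ℝ) ^ 2 := le_self_pow₀ hn1' two_ne_zero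
        have := mul_le_mul_of_nonneg_right hn2 (Real.exp_pos (-(n : ℝ) ^ ε)).le
        linarith

end UpperTail

/-! ### The lower tail -/

section LowerTail

/-- First moment bound: the probability that there are `k` vertex-disjoint copies of a graph all
of whose weights are at most `p`. -/
lemma prob_exists_disjoint_light_copies_le {W : Type*} [Fintype W] (G : SimpleGraph W) {n : ℕ}
    {ν : Measure ℝ} (hν : IsEdgeLaw ν) {p : ℝ} (hp : 0 ≤ p) (k : ℕ) :
    (Measure.pi fun _ : KnEdge n => ν).real
      {x | ∃ 𝒮 : Finset (W ↪ Fin n), 𝒮.card = k ∧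
        (∀ ψ ∈ 𝒮, ∀ ψ' ∈ 𝒮, ψ ≠ ψ' → Disjoint (Set.range ψ) (Set.range ψ')) ∧
        ∀ ψ ∈ 𝒮, ∀ e ∈ copyEdges G ψ, x e ≤ p}
      ≤ ((n : ℝ) ^ Fintype.card W * p ^ G.edgeSet.ncard) ^ k / k.factorial := by
  classical
  have := hν.isProb
  let good : Finset (W ↪ Fin n) → Prop := fun 𝒮 =>
    ∀ ψ ∈ 𝒮, ∀ ψ' ∈ 𝒮, ψ ≠ ψ' → Disjoint (Set.range ψ) (Set.range ψ')
  let 𝓕 := (Finset.powersetCard k (Finset.univ : Finset (W ↪ Fin n))).filter good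
  have hsub : {x : KnEdge n → ℝ | ∃ 𝒮 : Finset (W ↪ Fin n), 𝒮.card = k ∧
        (∀ ψ ∈ 𝒮, ∀ ψ' ∈ 𝒮, ψ ≠ ψ' → Disjoint (Set.range ψ) (Set.range ψ')) ∧
        ∀ ψ ∈ 𝒮, ∀ e ∈ copyEdges G ψ, x e ≤ p}
      ⊆ ⋃ 𝒮 ∈ 𝓕, {x | ∀ e ∈ 𝒮.biUnion (copyEdges G), x e ≤ p} := by
    rintro x ⟨𝒮, h1, h2, h3⟩
    refine Set.mem_biUnion (x := 𝒮) ?_ ?_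
    · simp only [𝓕, Finset.coe_filter, mem_ofPred_eq]
      exact ⟨Finset.mem_powersetCard.2 ⟨Finset.subset_univ _, h1⟩, h2⟩
    · intro e he
      obtain ⟨ψ, hψ, he⟩ := Finset.mem_biUnion.1 he
      exact h3 ψ hψ e he
  refine (measureReal_mono hsub (measure_ne_top _ _)).trans
    ((measureReal_biUnion_finset_le _ _).trans ?_)
  have h1 : ∀ 𝒮 ∈ 𝓕, (Measure.pi fun _ : KnEdge n => ν).real
      {x | ∀ e ∈ 𝒮.biUnion (copyEdges G), x e ≤ p} ≤ (p ^ G.edgeSet.ncard) ^ k := by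
    intro 𝒮 h𝒮
    obtain ⟨h𝒮, hgood⟩ := Finset.mem_filter.1 h𝒮
    rw [measureReal_pi_forall_mem_le, Finset.card_biUnion]
    · simp only [card_copyEdges]
      rw [Finset.sum_const, (Finset.mem_powersetCard.1 h𝒮).2, smul_eq_mul, mul_comm, pow_mul]
      exact pow_le_pow_left₀ (by positivity)
        (pow_le_pow_left₀ measureReal_nonneg (hν.le p hp) _) _
    · intro ψ hψ ψ' hψ' hne
      refine Finset.disjoint_left.2 fun e he he' => ?_
      rw [mem_copyEdges] at he he'
      have hd := hgood ψ hψ ψ' hψ' hne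
      rw [← verts_copySubgraph G, ← verts_copySubgraph G] at hd
      obtain ⟨e, hes⟩ := e
      induction e with | _ a b =>
      exact Set.disjoint_left.1 hd ((copySubgraph G ψ).edge_vert he)
        ((copySubgraph G ψ').edge_vert he')
  refine (Finset.sum_le_card_nsmul _ _ _ h1).trans ?_
  rw [nsmul_eq_mul, mul_pow, mul_div_right_comm]
  refine mul_le_mul_of_nonneg_right ?_ (by positivity)
  have h2 : 𝓕.card ≤ (Fintype.card (W ↪ Fin n)).choose k := by
    refine (Finset.card_filter_le _ _).trans ?_
    rw [Finset.card_powersetCard, Finset.card_univ]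
  have h3 : (Fintype.card (W ↪ Fin n) : ℝ) ≤ (n : ℝ) ^ Fintype.card W := by
    rw [Fintype.card_embedding_eq, Fintype.card_fin]
    exact_mod_cast Nat.descFactorial_le_pow _ _
  calc (𝓕.card : ℝ) ≤ ((Fintype.card (W ↪ Fin n)).choose k : ℝ) := by exact_mod_cast h2
    _ ≤ (Fintype.card (W ↪ Fin n) : ℝ) ^ k / k.factorial := Nat.choose_le_pow_div k _
    _ ≤ _ := by gcongr

variable {V : Type*} [Fintype V] (H : SimpleGraph V) {n : ℕ}

lemma copyEdges_subgraph_subset (G : H.Subgraph) [Fintype G.verts] (φ : V ↪ Fin n) :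
    copyEdges G.coe ((Function.Embedding.subtype _).trans φ) ⊆ copyEdges H φ := by
  intro e he
  obtain ⟨a, ha, h⟩ := exists_of_mem_copyEdges _ he
  have ha' : Sym2.map Subtype.val a ∈ H.edgeSet := by
    refine G.edgeSet_subset ?_
    rw [← G.image_coe_edgeSet_coe]
    exact Set.mem_image_of_mem _ ha
  rw [mem_copyEdges, copySubgraph, SimpleGraph.Copy.toSubgraph, SimpleGraph.Subgraph.edgeSet_map]
  refine ⟨_, by simpa using ha', ?_⟩
  rw [← h]
  change Sym2.map φ (Sym2.map Subtype.val a) = _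
  rw [Sym2.map_map]; rfl

/-- A factor of small weight contains many vertex-disjoint light copies of `H`, and hence of each
of its subgraphs. -/
lemma exists_disjoint_light_copies (G₀ : H.Subgraph) [Fintype G₀.verts] (hG₀ : G₀.verts.Nonempty)
    {α : ℝ} {x : KnEdge n → ℝ} (hx : ∀ e, 0 ≤ x e) {Q : Finset (Kn n).Subgraph}
    (hQ : IsPartialFactor H n α Q) {p w : ℝ} (hp : 0 < p) (hw : totalWeight x Q ≤ w * p) {k : ℕ}
    (hk : (Fintype.card V : ℝ) * (k + w) ≤ (1 - α) * n) :
    ∃ 𝒮 : Finset (G₀.verts ↪ Fin n), 𝒮.card = k ∧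
      (∀ ψ ∈ 𝒮, ∀ ψ' ∈ 𝒮, ψ ≠ ψ' → Disjoint (Set.range ψ) (Set.range ψ')) ∧
      ∀ ψ ∈ 𝒮, ∀ e ∈ copyEdges G₀.coe ψ, x e ≤ p := by
  classical
  obtain ⟨v₀, hv₀⟩ := hG₀
  have hV : (0 : ℝ) < Fintype.card V := by
    have : Nonempty V := ⟨v₀⟩
    exact_mod_cast Fintype.card_pos
  have hex : ∀ G : Q, ∃ φ : V ↪ Fin n, copySubgraph H φ = G.1 := fun G =>
    exists_copySubgraph_eq H (hQ.iso G.1 G.2)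
  choose φ hφ using hex
  let wt : Q → ℝ := fun G => ∑ e ∈ copyEdges H (φ G), x e
  have hwt0 : ∀ G, 0 ≤ wt G := fun G => Finset.sum_nonneg fun e _ => hx e
  have htot : totalWeight x Q = ∑ G, wt G := by
    rw [totalWeight, ← Finset.sum_attach]
    refine Finset.sum_congr rfl fun G _ => ?_
    dsimp only [wt]
    rw [← hφ G]
    simp only [← mem_copyEdges]
    rw [Finset.sum_ite_mem, Finset.univ_inter]
  have hcov : (1 - α) * n ≤ Fintype.card V * Q.card := by
    refine hQ.cover.trans ?_
    have h1 : (⋃ G ∈ Q, G.verts).ncard ≤ ∑ G ∈ Q, G.verts.ncard :=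
      Finset.set_ncard_biUnion_le Q _
    have h2 : ∀ G ∈ Q, G.verts.ncard = Fintype.card V := by
      intro G hG
      have hG' : G.verts = Set.range (φ ⟨G, hG⟩) := by
        rw [← verts_copySubgraph H, hφ ⟨G, hG⟩]
      rw [hG', ← Set.image_univ,
        Set.ncard_image_of_injective _ (φ _).injective, Set.ncard_univ, Nat.card_eq_fintype_card]
    rw [Finset.sum_congr rfl h2, Finset.sum_const, smul_eq_mul, mul_comm] at h1
    exact_mod_cast h1
  let light := (Finset.univ : Finset Q).filter fun G => wt G ≤ p
  have hheavy : (((Finset.univ : Finset Q).filter fun G => ¬ wt G ≤ p).card : ℝ) ≤ w := by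
    refine le_of_mul_le_mul_right (le_trans ?_ (htot ▸ hw)) hp
    rw [← nsmul_eq_mul]
    refine (Finset.card_nsmul_le_sum _ wt p fun G hG => ?_).trans
      (Finset.sum_le_sum_of_subset_of_nonneg (Finset.subset_univ _) fun G _ _ => hwt0 G)
    exact (not_le.1 (Finset.mem_filter.1 hG).2).le
  have hklight : k ≤ light.card := by
    have h1 := Finset.card_filter_add_card_filter_not (s := (Finset.univ : Finset Q))
      (fun G => wt G ≤ p)
    rw [Finset.card_univ, Fintype.card_coe] at h1
    have h2 : (light.card : ℝ) + ((Finset.univ : Finset Q).filter fun G => ¬ wt G ≤ p).card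
        = Q.card := by exact_mod_cast h1
    have h3 : (k : ℝ) + w ≤ Q.card := le_of_mul_le_mul_left (hk.trans hcov) hV
    have h4 : (k : ℝ) ≤ light.card := by linarith
    exact_mod_cast h4
  obtain ⟨Q', hQ', hcard⟩ := Finset.exists_subset_card_eq hklight
  let ψ : Q → (G₀.verts ↪ Fin n) := fun G => (Function.Embedding.subtype _).trans (φ G)
  have hrange : ∀ G : Q, Set.range (ψ G) ⊆ G.1.verts := by
    rintro G _ ⟨u, rfl⟩
    rw [← hφ G, verts_copySubgraph]
    exact ⟨u.1, rfl⟩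
  have hdisj : ∀ G G' : Q, G ≠ G' → Disjoint (Set.range (ψ G)) (Set.range (ψ G')) :=
    fun G G' h => (hQ.disjoint G.1 G.2 G'.1 G'.2 fun h' => h (Subtype.ext h')).mono
      (hrange G) (hrange G')
  have hinj : Function.Injective ψ := by
    intro G G' h
    by_contra hne
    have := hdisj G G' hne
    rw [h, disjoint_self] at this
    exact Set.Nonempty.ne_empty (s := Set.range (ψ G')) ⟨_, ⟨v₀, hv₀⟩, rfl⟩ this
  refine ⟨Q'.image ψ, by rw [Finset.card_image_of_injective _ hinj, hcard], ?_, ?_⟩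
  · intro a ha b hb hne
    obtain ⟨G, -, rfl⟩ := Finset.mem_image.1 ha
    obtain ⟨G', -, rfl⟩ := Finset.mem_image.1 hb
    exact hdisj G G' fun h => hne (h ▸ rfl)
  · intro a ha e he
    obtain ⟨G, hG, rfl⟩ := Finset.mem_image.1 ha
    have hl := (Finset.mem_filter.1 (hQ' hG)).2
    exact (Finset.single_le_sum (f := x) (fun e _ => hx e)
      (copyEdges_subgraph_subset H G₀ (φ G) he)).trans hl

/-- The lower tail: a factor of weight at most `a n ^ (1 - 1/d^*)` would contain linearly many
disjoint copies of a densest subgraph with weights of order `n ^ (-1/d^*)`, which a first moment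
computation excludes. -/
theorem lower_tail {ν : Measure ℝ} (hν : IsEdgeLaw ν) (hd : 1 < maxDensity H) [Nonempty V]
    {α : ℝ} (hα0 : 0 ≤ α) (hα1 : α < 1) :
    ∃ a : ℝ, 0 < a ∧ ∀ K : ℝ, ∀ᶠ n : ℕ in atTop, Fintype.card V ∣ n →
      (Measure.pi fun _ : KnEdge n => ν).real
        {x | ¬ a * (n : ℝ) ^ (1 - 1 / maxDensity H) ≤ minFactorWeight H (α * n) n x}
        ≤ (n : ℝ) ^ (-K) := by
  classical
  have := hν.isProb
  have hd0 : 0 < maxDensity H := by linarith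
  obtain ⟨G₀, hv2, he1, hdens⟩ := exists_densest_subgraph H hd0
  have : Fintype G₀.verts := Fintype.ofFinite _
  set d := maxDensity H with hdd
  set v := Fintype.card V with hv
  have hv1 : (1 : ℝ) ≤ v := by rw [hv]; exact_mod_cast Fintype.card_pos
  set κ := (1 - α) / (3 * v) with hκ
  have hκ0 : 0 < κ := div_pos (by linarith) (by positivity)
  have hκ1 : κ ≤ 1 := by rw [hκ, div_le_one (by positivity)]; linarith
  have hκv : v * (3 * κ) = 1 - α := by rw [hκ]; field_simp
  -- small enough for the first moment bound to decay like `exp (-k)` when `k ≥ κ n`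
  set a' := κ / 2 * Real.exp (-2) with ha'
  have ha'0 : 0 < a' := by positivity
  have ha'1 : a' ≤ 1 := by
    have : Real.exp (-2) ≤ 1 := Real.exp_le_one_iff.2 (by norm_num)
    rw [ha']; nlinarith
  refine ⟨a' * κ, by positivity, fun K => ?_⟩
  filter_upwards [eventually_mul_exp_neg_le 1 hκ0 one_pos K, eventually_ge_atTop 1,
    (tendsto_natCast_atTop_atTop (R := ℝ)).eventually_ge_atTop (1 / κ)] with n hK hn1 hnκ hdvd
  have hn0 : (0 : ℝ) < n := by exact_mod_cast hn1
  have hn1' : (1 : ℝ) ≤ n := by exact_mod_cast hn1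
  have hκn : 1 ≤ κ * n := by rwa [div_le_iff₀' hκ0] at hnκ
  refine le_trans ?_ hK
  set p := a' * (n : ℝ) ^ (-(1 / d)) with hp
  have hp0 : 0 < p := by positivity
  set k := ⌈κ * n⌉₊ with hk
  have hk1 : κ * n ≤ k := Nat.le_ceil _
  have hk2 : (k : ℝ) ≤ 2 * (κ * n) := by
    have := (Nat.ceil_lt_add_one (show 0 ≤ κ * n by positivity)).le
    linarith
  set μ := Measure.pi fun _ : KnEdge n => ν with hμ
  have hincl : {x | ¬ a' * κ * (n : ℝ) ^ (1 - 1 / d) ≤ minFactorWeight H (α * n) n x} ≤ᵐ[μ]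
      {x | ∃ 𝒮 : Finset (G₀.verts ↪ Fin n), 𝒮.card = k ∧
        (∀ ψ ∈ 𝒮, ∀ ψ' ∈ 𝒮, ψ ≠ ψ' → Disjoint (Set.range ψ) (Set.range ψ')) ∧
        ∀ ψ ∈ 𝒮, ∀ e ∈ copyEdges G₀.coe ψ, x e ≤ p} := by
    filter_upwards [hν.ae_pi_nonneg (E := KnEdge n)] with x hx hbad
    have hα : α * n / n = α := mul_div_cancel_right₀ _ hn0.ne'
    have hne := factorEdgeSets_nonempty H hdvd (k := α * n) (by positivity)
    have hbad' := not_le.1 hbad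
    rw [minFactorWeight_eq_minSum H hne] at hbad'
    obtain ⟨B, hB, hBeq⟩ := exists_minSum_eq hne x
    simp only [factorEdgeSets, Set.Finite.mem_toFinset] at hB
    obtain ⟨Q, hQ, rfl⟩ := hB
    rw [hBeq, ← totalWeight_eq_sum hQ.disjoint] at hbad'
    rw [hα] at hQ
    refine exists_disjoint_light_copies H G₀ (Set.nonempty_of_ncard_ne_zero (by omega)) hx hQ
      (w := κ * n) hp0 (hbad'.le.trans (le_of_eq ?_)) ?_
    · rw [hp, sub_eq_add_neg, Real.rpow_add hn0, Real.rpow_one]; ring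
    · calc (v : ℝ) * (k + κ * n) ≤ v * (2 * (κ * n) + κ * n) := by gcongr
        _ = v * (3 * κ) * n := by ring
        _ = _ := by rw [hκv]
  have hle : μ.real {x | ¬ a' * κ * (n : ℝ) ^ (1 - 1 / d) ≤ minFactorWeight H (α * n) n x}
      ≤ ((n : ℝ) ^ Fintype.card G₀.verts * p ^ G₀.coe.edgeSet.ncard) ^ k / k.factorial :=
    (ENNReal.toReal_mono (measure_ne_top _ _) (measure_mono_ae hincl)).trans
      (prob_exists_disjoint_light_copies_le G₀.coe hν hp0.le k)
  refine hle.trans ?_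
  have hcardW : Fintype.card G₀.verts = G₀.verts.ncard := by
    rw [← Nat.card_coe_set_eq, Nat.card_eq_fintype_card]
  have hmean : (n : ℝ) ^ Fintype.card G₀.verts * p ^ G₀.coe.edgeSet.ncard ≤ a' * n := by
    rw [hcardW, ncard_edgeSet_coe, hp, mul_pow, ← Real.rpow_natCast ((n : ℝ) ^ _),
      ← Real.rpow_mul hn0.le, hdens, ← Real.rpow_natCast (n : ℝ), mul_left_comm,
      ← Real.rpow_add hn0]
    have e1 : (G₀.verts.ncard : ℝ) + -(1 / d) * (d * ((G₀.verts.ncard : ℝ) - 1)) = 1 := by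
      field_simp; ring
    rw [e1, Real.rpow_one]
    exact mul_le_mul_of_nonneg_right
      (pow_le_of_le_one ha'0.le ha'1 (by omega)) hn0.le
  have hmean2 : a' * n ≤ Real.exp (-2) * k := by
    calc a' * n = Real.exp (-2) * (κ * n) / 2 := by rw [ha']; ring
      _ ≤ Real.exp (-2) * (κ * n) := by
        have : 0 ≤ Real.exp (-2) * (κ * n) := by positivity
        linarith
      _ ≤ _ := by gcongr
  calc ((n : ℝ) ^ Fintype.card G₀.verts * p ^ G₀.coe.edgeSet.ncard) ^ k / k.factorial
      ≤ (Real.exp (-2) * k) ^ k / k.factorial :=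
        div_le_div_of_nonneg_right (pow_le_pow_left₀ (by positivity) (hmean.trans hmean2) k)
          (by positivity)
    _ = Real.exp (-2) ^ k * ((k : ℝ) ^ k / k.factorial) := by rw [mul_pow]; ring
    _ ≤ Real.exp (-2) ^ k * Real.exp k := by
        gcongr; exact Real.pow_div_factorial_le_exp _ (Nat.cast_nonneg _) _
    _ = Real.exp (-k) := by rw [← Real.exp_nat_mul, ← Real.exp_add]; congr 1; ring
    _ ≤ Real.exp (-(κ * (n : ℝ) ^ (1 : ℝ))) := by
        rw [Real.rpow_one, Real.exp_le_exp]; linarith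
    _ ≤ 1 * (n : ℝ) ^ 2 * Real.exp (-(κ * (n : ℝ) ^ (1 : ℝ))) := by
        rw [one_mul]
        exact le_mul_of_one_le_left (Real.exp_pos _).le (one_le_pow₀ hn1')

end LowerTail

/-! ### The uniform and the exponential edge laws -/

section Laws

lemma isEdgeLaw_uniform : IsEdgeLaw (volume.restrict (Icc (0 : ℝ) 1)) := by
  have hprob : IsProbabilityMeasure (volume.restrict (Icc (0 : ℝ) 1)) := ⟨by simp⟩
  have hcdf : ∀ p, 0 ≤ p → (volume.restrict (Icc (0 : ℝ) 1)).real (Iic p) = min 1 p := by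
    intro p hp
    have h : Iic p ∩ Icc 0 1 = Icc 0 (min 1 p) := by
      ext t; simp only [mem_inter_iff, mem_Iic, mem_Icc, le_min_iff]; tauto
    rw [measureReal_restrict_apply measurableSet_Iic, h, Real.volume_real_Icc_of_le, sub_zero]
    exact le_min zero_le_one hp
  refine ⟨hprob, ?_, fun p hp => ?_, fun p hp hp1 => ?_, fun T hT => ?_, ?_⟩
  · filter_upwards [ae_restrict_mem measurableSet_Icc] with t ht using ht.1
  · rw [hcdf p hp]; exact min_le_right _ _
  · rw [hcdf p hp, min_eq_right hp1]; linarith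
  · have h : Ioi T ∩ Icc (0 : ℝ) 1 = ∅ := by
      ext t; simp only [mem_inter_iff, mem_Ioi, mem_Icc, mem_empty_iff_false, iff_false]
      rintro ⟨h1, -, h2⟩; linarith
    rw [measureReal_restrict_apply measurableSet_Ioi, h, measureReal_empty]
    exact (Real.exp_pos _).le
  · refine MemLp.of_bound measurable_id.aestronglyMeasurable 1 ?_
    filter_upwards [ae_restrict_mem measurableSet_Icc] with t ht
    rw [id, Real.norm_eq_abs, abs_of_nonneg ht.1]; exact ht.2

lemma isEdgeLaw_exp : IsEdgeLaw (expMeasure 1) := by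
  have hprob : IsProbabilityMeasure (expMeasure 1) := isProbabilityMeasure_expMeasure one_pos
  have hcdf : ∀ p, 0 ≤ p → (expMeasure 1).real (Iic p) = 1 - Real.exp (-p) := by
    intro p hp
    rw [← cdf_eq_real, cdf_expMeasure_eq one_pos, if_pos hp, one_mul]
  refine ⟨hprob, ?_, fun p hp => ?_, fun p hp hp1 => ?_, fun T hT => ?_, ?_⟩
  · have h0 : expMeasure 1 (Iic 0) = 0 := by
      have := hcdf 0 le_rfl
      rw [neg_zero, Real.exp_zero, sub_self] at this
      exact (measureReal_eq_zero_iff).1 this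
    have h1 : ∀ᵐ t ∂(expMeasure 1), t ∉ Iic (0 : ℝ) := measure_eq_zero_iff_ae_notMem.1 h0
    filter_upwards [h1] with t ht using (not_le.1 ht).le
  · rw [hcdf p hp]
    have := Real.add_one_le_exp (-p)
    linarith
  · rw [hcdf p hp]
    have h1 : Real.exp (-p) ≤ 1 / (1 + p) := by
      rw [Real.exp_neg, ← one_div]
      exact one_div_le_one_div_of_le (by linarith) (by linarith [Real.add_one_le_exp p])
    have h2 : 1 / (1 + p) ≤ 1 - p / 2 := by
      rw [div_le_iff₀ (by linarith)]; nlinarith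
    linarith
  · rw [← compl_Iic, measureReal_compl measurableSet_Iic, probReal_univ, hcdf T (by linarith)]
    linarith
  · rw [memLp_two_iff_integrable_sq measurable_id.aestronglyMeasurable]
    have hG := Real.GammaIntegral_convergent (s := 3) (by norm_num)
    rw [expMeasure, gammaMeasure]
    have hpdf : gammaPDF 1 1 = fun x => ENNReal.ofReal (gammaPDFReal 1 1 x) := rfl
    rw [hpdf, integrable_withDensity_iff_integrable_smul₀' (by fun_prop) (by simp)]
    have hind : IntegrableOn (fun x : ℝ => (ENNReal.ofReal (gammaPDFReal 1 1 x)).toReal • id x ^ 2)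
        (Ioi 0) := by
      refine hG.congr_fun (fun x hx => ?_) measurableSet_Ioi
      have hx0 : (0 : ℝ) < x := hx
      have h1 : gammaPDFReal 1 1 x = Real.exp (-x) := by
        rw [gammaPDFReal, if_pos hx0.le]; simp
      simp only [h1, ENNReal.toReal_ofReal (Real.exp_pos _).le, id, smul_eq_mul]
      congr 1
      rw [show (3 : ℝ) - 1 = 2 by norm_num]
      norm_cast
    have hneg : IntegrableOn (fun x : ℝ => (ENNReal.ofReal (gammaPDFReal 1 1 x)).toReal • id x ^ 2)
        (Iic 0) := by
      refine (integrableOn_zero (μ := volume)).congr_fun_ae ?_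
      have : ∀ᵐ x : ℝ ∂(volume.restrict (Iic 0)), x ≠ 0 :=
        ae_restrict_of_ae (Measure.ae_ne volume 0)
      filter_upwards [ae_restrict_mem measurableSet_Iic, this] with x hx hx0
      have : x < 0 := lt_of_le_of_ne hx hx0
      rw [gammaPDFReal, if_neg (not_le.2 this)]
      simp
    rw [← integrableOn_univ, ← Iic_union_Ioi (a := (0 : ℝ))]
    exact hneg.union hind

lemma IsEdgeLaw.of_eq {ν : Measure ℝ}
    (h : ν = volume.restrict (Icc 0 1) ∨ ν = expMeasure 1) : IsEdgeLaw ν := by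
  rcases h with rfl | rfl
  exacts [isEdgeLaw_uniform, isEdgeLaw_exp]

end Laws

/-! ### Concentration -/

section Concentration

variable {V : Type*} [Fintype V] (H : SimpleGraph V) {ν : Measure ℝ}

omit [Fintype V] in
lemma minFactorWeight_nonneg {n : ℕ} {k : ℝ} {x : KnEdge n → ℝ} (hx : ∀ e, 0 ≤ x e) :
    0 ≤ minFactorWeight H k n x := by
  classical
  refine Real.sInf_nonneg ?_
  rintro _ ⟨Q, -, rfl⟩
  refine Finset.sum_nonneg fun G _ => Finset.sum_nonneg fun e _ => ?_
  split_ifs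
  exacts [hx e, le_rfl]

/-- The expectation of `F_H(k, n)` for independent edge weights with law `ν`. -/
noncomputable def meanFactorWeight (ν : Measure ℝ) (k : ℝ) (n : ℕ) : ℝ :=
  ∫ x, minFactorWeight H k n x ∂(Measure.pi fun _ : KnEdge n => ν)

omit [Fintype V] in
lemma meanFactorWeight_nonneg (hν : IsEdgeLaw ν) (k : ℝ) (n : ℕ) :
    0 ≤ meanFactorWeight H ν k n := by
  refine integral_nonneg_of_ae ?_
  filter_upwards [hν.ae_pi_nonneg (E := KnEdge n)] with x hx using minFactorWeight_nonneg H hx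

lemma exists_lipschitzWith_minFactorWeight [Nonempty V] {n : ℕ} (hn : Fintype.card V ∣ n) {k : ℝ}
    (hk : 0 ≤ k) : ∃ C, LipschitzWith C (minFactorWeight H k n) := by
  have hne := factorEdgeSets_nonempty H hn hk
  rw [show minFactorWeight H k n = minSum _ hne from
    funext fun x => minFactorWeight_eq_minSum H hne x]
  exact ⟨_, lipschitzWith_minSum hne⟩

lemma measurable_minFactorWeight [Nonempty V] {n : ℕ} (hn : Fintype.card V ∣ n) {k : ℝ}
    (hk : 0 ≤ k) : Measurable (minFactorWeight H k n) := by
  obtain ⟨C, hC⟩ := exists_lipschitzWith_minFactorWeight H hn hk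
  exact hC.continuous.measurable

/-- Chebyshev's inequality combined with the variance bound. -/
lemma prob_deviation_le (hν : IsEdgeLaw ν) [Nonempty V] {n : ℕ} (hn : Fintype.card V ∣ n) {k : ℝ}
    (hk : 0 ≤ k) {t : ℝ} (ht : 0 < t) :
    (Measure.pi fun _ : KnEdge n => ν).real
      {x | t ≤ |minFactorWeight H k n x - meanFactorWeight H ν k n|}
      ≤ edgeLawConst ν * meanFactorWeight H ν k n / t ^ 2 := by
  classical
  have := hν.isProb
  have hne := factorEdgeSets_nonempty H hn hk
  obtain ⟨C, hC⟩ := exists_lipschitzWith_minFactorWeight H hn hk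
  have hL2 := hC.memLp_two_pi ν hν.memLp
  have hvar := variance_minSum_le (ν := ν) hν hne
  rw [← show minFactorWeight H k n = minSum _ hne from
    funext fun x => minFactorWeight_eq_minSum H hne x] at hvar
  have hcheb := meas_ge_le_variance_div_sq hL2 ht
  rw [variance_eq_sub hL2] at hcheb
  refine (ENNReal.toReal_le_of_le_ofReal ?_ (hcheb.trans (ENNReal.ofReal_le_ofReal ?_)))
  · exact div_nonneg (mul_nonneg (edgeLawConst_nonneg ν) (meanFactorWeight_nonneg H hν k n))
      (sq_nonneg t)
  · exact div_le_div_of_nonneg_right hvar (sq_nonneg t)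

lemma one_le_measureReal_add_compl {Ω : Type*} [MeasurableSpace Ω] (P : Measure Ω)
    [IsProbabilityMeasure P] (A : Set Ω) : 1 ≤ P.real A + P.real Aᶜ := by
  have := measureReal_union_le (μ := P) A Aᶜ
  rwa [union_compl_self, probReal_univ] at this

lemma nonempty_of_one_lt_maxDensity {V : Type*} {H : SimpleGraph V} (hd : 1 < maxDensity H) :
    Nonempty V := by
  by_contra hV
  rw [not_nonempty_iff] at hV
  have hac : H.IsAcyclic := SimpleGraph.IsAcyclic.of_subsingleton
  exact (one_lt_maxDensity_iff H).1 hd hac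

lemma eventually_rpow_neg_one_le {δ : ℝ} (hδ : 0 < δ) :
    ∀ᶠ n : ℕ in atTop, (n : ℝ) ^ (-1 : ℝ) ≤ δ := by
  have h : Tendsto (fun n : ℕ => (n : ℝ) ^ (-1 : ℝ)) atTop (nhds 0) :=
    (tendsto_rpow_neg_atTop one_pos).comp tendsto_natCast_atTop_atTop
  exact h.eventually_le_const hδ

/-- The expectation has the order of magnitude given by the tail bounds. The upper bound combines
the upper tail with Chebyshev's inequality. -/
lemma meanFactorWeight_bounds (hν : IsEdgeLaw ν) (hd : 1 < maxDensity H) {α : ℝ} (hα0 : 0 ≤ α)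
    (hα1 : α < 1) : ∃ a b : ℝ, 0 < a ∧ 0 < b ∧ ∀ᶠ n : ℕ in atTop, Fintype.card V ∣ n →
      a * (n : ℝ) ^ (1 - 1 / maxDensity H) ≤ meanFactorWeight H ν (α * n) n ∧
      meanFactorWeight H ν (α * n) n ≤ b * (n : ℝ) ^ (1 - 1 / maxDensity H) := by
  have := hν.isProb
  have := nonempty_of_one_lt_maxDensity hd
  obtain ⟨b, hb0, hb⟩ := upper_tail H hν hd
  obtain ⟨a, ha0, ha⟩ := lower_tail H hν hd hα0 hα1
  set C := edgeLawConst ν with hC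
  have hC0 : 0 ≤ C := edgeLawConst_nonneg ν
  refine ⟨a / 2, 2 * b + (4 * C + 2), by positivity, by positivity, ?_⟩
  have hexp : 0 < 1 - 1 / maxDensity H := by
    rw [sub_pos, div_lt_one (by linarith)]; exact hd
  filter_upwards [ha 1, hb 1, eventually_rpow_neg_one_le (δ := 1 / 4) (by norm_num),
    eventually_ge_atTop 1] with n hna hnb hn4 hn1 hdvd
  have hn1' : (1 : ℝ) ≤ n := by exact_mod_cast hn1
  have hkn : 0 ≤ α * n := by positivity
  have h1 := (hna hdvd).trans hn4
  have h2 := (hnb hdvd (α * n) hkn).trans hn4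
  set L := (n : ℝ) ^ (1 - 1 / maxDensity H) with hL
  have hL1 : 1 ≤ L := Real.one_le_rpow hn1' hexp.le
  set μ := Measure.pi fun _ : KnEdge n => ν with hμ
  set m := meanFactorWeight H ν (α * n) n with hm
  have hm0 : 0 ≤ m := meanFactorWeight_nonneg H hν _ n
  constructor
  · obtain ⟨C', hC'⟩ := exists_lipschitzWith_minFactorWeight H hdvd hkn
    have hint := (hC'.memLp_two_pi ν hν.memLp).integrable one_le_two
    have hmk := mul_meas_ge_le_integral_of_nonneg (μ := μ) (f := minFactorWeight H (α * n) n)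
      (by filter_upwards [hν.ae_pi_nonneg (E := KnEdge n)] with x hx
          using minFactorWeight_nonneg H hx) hint (a * L)
    have h3 := one_le_measureReal_add_compl μ {x | a * L ≤ minFactorWeight H (α * n) n x}
    have h4 : μ.real {x | a * L ≤ minFactorWeight H (α * n) n x}ᶜ ≤ 1 / 4 := h1
    have h5 : 1 / 2 ≤ μ.real {x | a * L ≤ minFactorWeight H (α * n) n x} := by linarith
    have h6 := mul_le_mul_of_nonneg_left h5 (show 0 ≤ a * L by positivity)
    change _ ≤ ∫ x, minFactorWeight H (α * n) n x ∂μ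
    linarith
  · by_contra hcon
    push Not at hcon
    -- with this `t`, Chebyshev's inequality bounds the probability of a deviation by `1 / 2`
    set t := m / 2 + (2 * C + 1) with ht
    have ht0 : 0 < t := by positivity
    have h3 := prob_deviation_le H hν hdvd hkn ht0
    rw [← hm, ← hC] at h3
    have h4 : C * m / t ^ 2 ≤ 1 / 2 := by
      rw [div_le_iff₀ (by positivity), ht]
      nlinarith [mul_nonneg hC0 hm0, sq_nonneg m]
    have h5 := one_le_measureReal_add_compl μ {x | minFactorWeight H (α * n) n x ≤ b * L}
    have h6 : μ.real {x | minFactorWeight H (α * n) n x ≤ b * L}ᶜ ≤ 1 / 4 := h2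
    have h7 : μ.real {x | minFactorWeight H (α * n) n x ≤ b * L}
        ≤ μ.real {x | t ≤ |minFactorWeight H (α * n) n x - m|} := by
      refine measureReal_mono (fun x hx => ?_) (measure_ne_top _ _)
      have hx' : minFactorWeight H (α * n) n x ≤ b * L := hx
      change t ≤ |minFactorWeight H (α * n) n x - m|
      refine le_trans ?_ (neg_le_abs (minFactorWeight H (α * n) n x - m))
      have h8 : (4 * C + 2) ≤ (4 * C + 2) * L := le_mul_of_one_le_right (by positivity) hL1
      rw [ht]; linarith
    linarith

/-- The fluctuations around the expectation are of order at most the square root of the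
expectation. -/
lemma eventually_prob_deviation_lt (hν : IsEdgeLaw ν) (hd : 1 < maxDensity H) {α : ℝ}
    (hα0 : 0 ≤ α) (hα1 : α < 1) {ε : ℝ} (hε : 0 < ε) : ∃ c : ℝ, 0 < c ∧
      ∀ᶠ n : ℕ in atTop, Fintype.card V ∣ n → (Measure.pi fun _ : KnEdge n => ν).real
        {x | c * √((n : ℝ) ^ (1 - 1 / maxDensity H)) ≤
          |minFactorWeight H (α * n) n x - meanFactorWeight H ν (α * n) n|} < ε := by
  have := nonempty_of_one_lt_maxDensity hd
  obtain ⟨a, b, ha0, hb0, hab⟩ := meanFactorWeight_bounds H hν hd hα0 hα1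
  set C := edgeLawConst ν with hC
  have hC0 : 0 ≤ C := edgeLawConst_nonneg ν
  refine ⟨√((C * b + 1) / ε), by positivity, ?_⟩
  filter_upwards [hab, eventually_ge_atTop 1] with n hn hn1 hdvd
  have hn0 : (0 : ℝ) < n := by exact_mod_cast hn1
  set L := (n : ℝ) ^ (1 - 1 / maxDensity H) with hL
  have hL0 : 0 < L := by positivity
  refine (prob_deviation_le H hν hdvd (by positivity) (by positivity)).trans_lt ?_
  rw [mul_pow, Real.sq_sqrt (by positivity), Real.sq_sqrt hL0.le, div_lt_iff₀ (by positivity)]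
  have h1 := mul_le_mul_of_nonneg_left (hn hdvd).2 hC0
  calc C * meanFactorWeight H ν (α * n) n ≤ C * (b * L) := h1
    _ < (C * b + 1) * L := by linarith
    _ = ε * ((C * b + 1) / ε * L) := by field_simp

/-- Centerings that are close to the expectation and of the right order satisfy the concentration
statement, with room to spare between the exponents `1/2` and `3/4`. -/
lemma exists_prob_lt_of_close (hν : IsEdgeLaw ν) (hd : 1 < maxDensity H) {α : ℝ}
    (hα0 : 0 ≤ α) (hα1 : α < 1) {a c : ℝ} (ha : 0 < a) (hc : 0 ≤ c) {ε : ℝ} (hε : 0 < ε) :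
    ∃ C : ℝ, ∀ᶠ n : ℕ in atTop, Fintype.card V ∣ n → ∀ M : ℝ,
      a * (n : ℝ) ^ (1 - 1 / maxDensity H) ≤ M →
      |M - meanFactorWeight H ν (α * n) n| ≤ c * √((n : ℝ) ^ (1 - 1 / maxDensity H)) →
      (Measure.pi fun _ : KnEdge n => ν).real
        {x | C * |M ^ (3 / 4 : ℝ)| < |minFactorWeight H (α * n) n x - M|} < ε := by
  have := hν.isProb
  obtain ⟨c', hc'0, hc'⟩ := eventually_prob_deviation_lt H hν hd hα0 hα1 hε
  have hexp : 0 < 1 - 1 / maxDensity H := by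
    rw [sub_pos, div_lt_one (by linarith)]; exact hd
  have hapos : 0 < a ^ (3 / 4 : ℝ) := by positivity
  refine ⟨(c + c') / a ^ (3 / 4 : ℝ), ?_⟩
  filter_upwards [hc', eventually_ge_atTop 1] with n hn hn1 hdvd M hM1 hM2
  have hn1' : (1 : ℝ) ≤ n := by exact_mod_cast hn1
  refine lt_of_le_of_lt (measureReal_mono (fun x hx => ?_) (measure_ne_top _ _)) (hn hdvd)
  set L := (n : ℝ) ^ (1 - 1 / maxDensity H) with hL
  have hL1 : 1 ≤ L := Real.one_le_rpow hn1' hexp.le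
  have hM0 : 0 ≤ M := le_trans (by positivity) hM1
  have h1 : a ^ (3 / 4 : ℝ) * √L ≤ M ^ (3 / 4 : ℝ) := by
    calc a ^ (3 / 4 : ℝ) * √L ≤ a ^ (3 / 4 : ℝ) * L ^ (3 / 4 : ℝ) := by
          gcongr
          rw [Real.sqrt_eq_rpow]
          exact Real.rpow_le_rpow_of_exponent_le hL1 (by norm_num)
      _ = (a * L) ^ (3 / 4 : ℝ) := (Real.mul_rpow ha.le (by linarith)).symm
      _ ≤ _ := Real.rpow_le_rpow (by positivity) hM1 (by norm_num)
  have h2 : (c + c') * √L ≤ (c + c') / a ^ (3 / 4 : ℝ) * |M ^ (3 / 4 : ℝ)| := by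
    rw [abs_of_nonneg (by positivity)]
    calc (c + c') * √L = (c + c') / a ^ (3 / 4 : ℝ) * (a ^ (3 / 4 : ℝ) * √L) := by field_simp
      _ ≤ _ := mul_le_mul_of_nonneg_left h1 (by positivity)
  have h3 : (c + c') / a ^ (3 / 4 : ℝ) * |M ^ (3 / 4 : ℝ)|
      < |minFactorWeight H (α * n) n x - M| := hx
  have h4 := abs_sub_le (minFactorWeight H (α * n) n x) (meanFactorWeight H ν (α * n) n) M
  rw [abs_sub_comm (meanFactorWeight H ν (α * n) n) M] at h4
  change c' * √L ≤ _
  linarith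

end Concentration

/-! ### Transfer to arbitrary probability spaces and conclusion -/

section Transfer

lemma IsIIDWeights.map_eq {n : ℕ} {Ω : Type*} [MeasurableSpace Ω] {P : Measure Ω}
    [IsProbabilityMeasure P] {X : KnEdge n → Ω → ℝ} {ν : Measure ℝ} (h : IsIIDWeights P X ν) :
    P.map (fun ω e => X e ω) = Measure.pi fun _ : KnEdge n => ν := by
  rw [(iIndepFun_iff_map_fun_eq_pi_map fun e => (h.2 e).aemeasurable).1 h.1]
  congr 1
  ext1 e
  exact (h.2 e).map_eq

lemma IsIIDWeights.measureReal_eq {n : ℕ} {Ω : Type*} [MeasurableSpace Ω] {P : Measure Ω}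
    [IsProbabilityMeasure P] {X : KnEdge n → Ω → ℝ} {ν : Measure ℝ} (h : IsIIDWeights P X ν)
    {S : Set (KnEdge n → ℝ)} (hS : MeasurableSet S) :
    P.real {ω | (fun e => X e ω) ∈ S} = (Measure.pi fun _ : KnEdge n => ν).real S := by
  rw [← h.map_eq, map_measureReal_apply_of_aemeasurable
    (aemeasurable_pi_iff.2 fun e => (h.2 e).aemeasurable) hS]
  rfl

end Transfer

section Conclusion

variable {V : Type*} [Fintype V] (H : SimpleGraph V) {ν : Measure ℝ}

/-- Every median of the minimum weight is within `O(√L)` of the expectation and at least a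
constant multiple of `L`, where `L = n ^ (1 - 1/d^*)`. -/
lemma median_bounds (hν : IsEdgeLaw ν) (hd : 1 < maxDensity H) {α : ℝ} (hα0 : 0 ≤ α)
    (hα1 : α < 1) : ∃ a c : ℝ, 0 < a ∧ 0 ≤ c ∧ ∀ᶠ n : ℕ in atTop, Fintype.card V ∣ n → ∀ M : ℝ,
      IsMedian (Measure.pi fun _ : KnEdge n => ν) (minFactorWeight H (α * n) n) M →
      a * (n : ℝ) ^ (1 - 1 / maxDensity H) ≤ M ∧
      |M - meanFactorWeight H ν (α * n) n| ≤ c * √((n : ℝ) ^ (1 - 1 / maxDensity H)) := by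
  have := hν.isProb
  have := nonempty_of_one_lt_maxDensity hd
  obtain ⟨a, ha0, ha⟩ := lower_tail H hν hd hα0 hα1
  obtain ⟨c, hc0, hc⟩ := eventually_prob_deviation_lt H hν hd hα0 hα1 (ε := 1 / 2) (by norm_num)
  refine ⟨a, c, ha0, hc0.le, ?_⟩
  filter_upwards [ha 1, hc, eventually_rpow_neg_one_le (δ := 1 / 4) (by norm_num)]
    with n hna hnc hn4 hdvd M hM
  have h1 := (hna hdvd).trans hn4
  have h2 := hnc hdvd
  set L := (n : ℝ) ^ (1 - 1 / maxDensity H) with hL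
  constructor
  · by_contra hcon
    push Not at hcon
    have h3 := measureReal_mono (μ := Measure.pi fun _ : KnEdge n => ν)
      (s₁ := {x | minFactorWeight H (α * n) n x ≤ M})
      (s₂ := {x | ¬ a * L ≤ minFactorWeight H (α * n) n x})
      (fun x hx => not_le.2 (lt_of_le_of_lt hx hcon)) (measure_ne_top _ _)
    have h4 := hM.1
    linarith
  · by_contra hcon
    push Not at hcon
    have hsub : ∀ S : Set (KnEdge n → ℝ), (∀ x ∈ S, c * √L ≤
        |minFactorWeight H (α * n) n x - meanFactorWeight H ν (α * n) n|) →
        (Measure.pi fun _ : KnEdge n => ν).real S < 1 / 2 := fun S hS =>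
      lt_of_le_of_lt (measureReal_mono hS (measure_ne_top _ _)) h2
    rcases lt_abs.1 hcon with h | h
    · refine absurd hM.2 (not_le.2 (hsub _ fun x hx => ?_))
      have hx' : M ≤ minFactorWeight H (α * n) n x := hx
      exact le_trans (by linarith) (le_abs_self _)
    · refine absurd hM.1 (not_le.2 (hsub _ fun x hx => ?_))
      have hx' : minFactorWeight H (α * n) n x ≤ M := hx
      exact le_trans (by linarith) (neg_le_abs _)

lemma eventually_multiplesAtTop {v : ℕ} {p : ℕ → Prop} :
    (∀ᶠ n in multiplesAtTop v, p n) ↔ ∀ᶠ n : ℕ in atTop, v ∣ n → p n :=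
  eventually_inf_principal

lemma holdsWithVeryHighProb_minFactorWeight (hν : IsEdgeLaw ν) (hd : 1 < maxDensity H) {α : ℝ}
    (hα0 : 0 ≤ α) (hα1 : α < 1) : ∃ a b : ℝ, 0 < a ∧ a < b ∧ ∀ K : ℝ, ∀ᶠ n : ℕ in atTop,
      Fintype.card V ∣ n → (Measure.pi fun _ : KnEdge n => ν).real
        {x | a * (n : ℝ) ^ (1 - 1 / maxDensity H) ≤ minFactorWeight H (α * n) n x ∧
          minFactorWeight H (α * n) n x ≤ b * (n : ℝ) ^ (1 - 1 / maxDensity H)}ᶜ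
        ≤ (n : ℝ) ^ (-K) := by
  have := hν.isProb
  have := nonempty_of_one_lt_maxDensity hd
  obtain ⟨b, hb0, hb⟩ := upper_tail H hν hd
  obtain ⟨a, ha0, ha⟩ := lower_tail H hν hd hα0 hα1
  refine ⟨a, a + b, ha0, by linarith, fun K => ?_⟩
  filter_upwards [ha (K + 1), hb (K + 1), eventually_ge_atTop 2] with n hna hnb hn2 hdvd
  have hn2' : (2 : ℝ) ≤ n := by exact_mod_cast hn2
  have hn0 : (0 : ℝ) < n := by linarith
  have h1 := hna hdvd
  have h2 := hnb hdvd (α * n) (by positivity)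
  have hsub : {x | a * (n : ℝ) ^ (1 - 1 / maxDensity H) ≤ minFactorWeight H (α * n) n x ∧
      minFactorWeight H (α * n) n x ≤ (a + b) * (n : ℝ) ^ (1 - 1 / maxDensity H)}ᶜ ⊆
      {x | ¬ a * (n : ℝ) ^ (1 - 1 / maxDensity H) ≤ minFactorWeight H (α * n) n x} ∪
      {x | ¬ minFactorWeight H (α * n) n x ≤ b * (n : ℝ) ^ (1 - 1 / maxDensity H)} := by
    intro x hx
    by_contra hcon
    simp only [mem_union, mem_ofPred_eq, not_or, not_not] at hcon
    have hL : 0 ≤ a * (n : ℝ) ^ (1 - 1 / maxDensity H) := by positivity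
    exact hx ⟨hcon.1, by rw [add_mul]; linarith [hcon.2]⟩
  calc _ ≤ (n : ℝ) ^ (-(K + 1)) + (n : ℝ) ^ (-(K + 1)) :=
        (measureReal_mono hsub (measure_ne_top _ _)).trans
          ((measureReal_union_le _ _).trans (add_le_add h1 h2))
    _ = 2 * (n : ℝ) ^ (-(K + 1)) := by ring
    _ ≤ n * (n : ℝ) ^ (-(K + 1)) := by gcongr
    _ = (n : ℝ) ^ (-K) := by
        have h3 : -K = 1 + -(K + 1) := by ring
        rw [h3, Real.rpow_add hn0, Real.rpow_one]

end Conclusion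

theorem mainTheorem1 {V : Type*} [Fintype V] (H : SimpleGraph V) :
    (1 < maxDensity H ↔ ¬ H.IsAcyclic) ∧
    (1 < maxDensity H →
      -- exponential weights, partial factors
      (∀ α : ℝ, 0 ≤ α → α < 1 →
        ∃ a b : ℝ, 0 < a ∧ a < b ∧
          ∀ (Ω : ℕ → Type*) [∀ n, MeasurableSpace (Ω n)] (P : ∀ n, Measure (Ω n))
            [∀ n, IsProbabilityMeasure (P n)] (X : ∀ n, KnEdge n → Ω n → ℝ),
            (∀ n, IsIIDWeights (P n) (X n) (expMeasure 1)) →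
            HoldsWithVeryHighProb (multiplesAtTop (Fintype.card V)) P
              (fun n => {ω |
                a * (n : ℝ) ^ (1 - 1 / maxDensity H)
                    ≤ minFactorWeight H (α * n) n (fun e => X n e ω) ∧
                minFactorWeight H (α * n) n (fun e => X n e ω)
                    ≤ b * (n : ℝ) ^ (1 - 1 / maxDensity H)}) ∧
            ∀ M : ℕ → ℝ,
              (∀ n, Fintype.card V ∣ n →
                IsMedian (P n)
                  (fun ω => minFactorWeight H (α * n) n (fun e => X n e ω)) (M n)) →
              IsBigOInProb (multiplesAtTop (Fintype.card V)) P
                (fun n ω => minFactorWeight H (α * n) n (fun e => X n e ω) - M n)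
                (fun n _ => M n ^ (3 / 4 : ℝ))) ∧
      -- uniform or exponential weights, factors
      (∀ ν : Measure ℝ, (ν = volume.restrict (Icc 0 1) ∨ ν = expMeasure 1) →
        ∃ M : ℕ → ℝ,
          Asymptotics.IsTheta (multiplesAtTop (Fintype.card V)) M
            (fun n => (n : ℝ) ^ (1 - 1 / maxDensity H)) ∧
          (∀ n, 0 ≤ M n) ∧
          ∀ (Ω : ℕ → Type*) [∀ n, MeasurableSpace (Ω n)] (P : ∀ n, Measure (Ω n))
            [∀ n, IsProbabilityMeasure (P n)] (X : ∀ n, KnEdge n → Ω n → ℝ),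
            (∀ n, IsIIDWeights (P n) (X n) ν) →
            IsBigOInProb (multiplesAtTop (Fintype.card V)) P
              (fun n ω => minFactorWeight H 0 n (fun e => X n e ω) - M n)
              (fun n _ => M n ^ (3 / 4 : ℝ)))) := by

  refine ⟨one_lt_maxDensity_iff H, fun hd => ⟨fun α hα0 hα1 => ?_, fun ν hν' => ?_⟩⟩
  · have hV := nonempty_of_one_lt_maxDensity hd
    have hν := isEdgeLaw_exp
    obtain ⟨a, b, ha0, hab, htail⟩ := holdsWithVeryHighProb_minFactorWeight H hν hd hα0 hα1
    refine ⟨a, b, ha0, hab, ?_⟩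
    intro Ω _ P _ X hX
    have hmeas : ∀ n : ℕ, Fintype.card V ∣ n → Measurable (minFactorWeight H (α * n) n) :=
      fun n hn => measurable_minFactorWeight H hn (by positivity)
    constructor
    · intro K
      rw [eventually_multiplesAtTop]
      filter_upwards [htail K] with n hn hdvd
      refine le_trans (le_of_eq ?_) (hn hdvd)
      refine (hX n).measureReal_eq (S := {x |
        a * (n : ℝ) ^ (1 - 1 / maxDensity H) ≤ minFactorWeight H (α * n) n x ∧
          minFactorWeight H (α * n) n x ≤ b * (n : ℝ) ^ (1 - 1 / maxDensity H)}ᶜ)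
        (MeasurableSet.compl ?_)
      exact (measurableSet_le measurable_const (hmeas n hdvd)).inter
        (measurableSet_le (hmeas n hdvd) measurable_const)
    · intro M hM ε hε
      obtain ⟨a', c', ha'0, hc'0, hmed⟩ := median_bounds H hν hd hα0 hα1
      obtain ⟨C, hC⟩ := exists_prob_lt_of_close H hν hd hα0 hα1 ha'0 hc'0 hε
      refine ⟨C, ?_⟩
      rw [eventually_multiplesAtTop]
      filter_upwards [hmed, hC] with n hn1 hn2 hdvd
      have hMn : IsMedian (Measure.pi fun _ : KnEdge n => expMeasure 1)
          (minFactorWeight H (α * n) n) (M n) := by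
        have h := hM n hdvd
        refine ⟨h.1.trans (le_of_eq ?_), h.2.trans (le_of_eq ?_)⟩
        · exact (hX n).measureReal_eq (measurableSet_le (hmeas n hdvd) measurable_const)
        · exact (hX n).measureReal_eq (measurableSet_le measurable_const (hmeas n hdvd))
      obtain ⟨h1, h2⟩ := hn1 hdvd (M n) hMn
      refine lt_of_le_of_lt (le_of_eq ?_) (hn2 hdvd (M n) h1 h2)
      refine (hX n).measureReal_eq (S := {x | C * |M n ^ (3 / 4 : ℝ)| <
        |minFactorWeight H (α * n) n x - M n|}) ?_
      exact measurableSet_lt measurable_const ((hmeas n hdvd).sub_const _).abs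
  · have hV := nonempty_of_one_lt_maxDensity hd
    have hν := IsEdgeLaw.of_eq hν'
    obtain ⟨a, b, ha0, hb0, hab⟩ := meanFactorWeight_bounds H hν hd le_rfl zero_lt_one
    simp only [zero_mul] at hab
    refine ⟨meanFactorWeight H ν 0, ⟨?_, ?_⟩, meanFactorWeight_nonneg H hν 0, ?_⟩
    · refine Asymptotics.IsBigO.of_bound b ?_
      rw [eventually_multiplesAtTop]
      filter_upwards [hab] with n hn hdvd
      rw [Real.norm_of_nonneg (meanFactorWeight_nonneg H hν 0 n),
        Real.norm_of_nonneg (by positivity)]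
      exact (hn hdvd).2
    · refine Asymptotics.IsBigO.of_bound a⁻¹ ?_
      rw [eventually_multiplesAtTop]
      filter_upwards [hab] with n hn hdvd
      rw [Real.norm_of_nonneg (meanFactorWeight_nonneg H hν 0 n),
        Real.norm_of_nonneg (by positivity), inv_mul_eq_div, le_div_iff₀' ha0]
      exact (hn hdvd).1
    · intro Ω _ P _ X hX ε hε
      obtain ⟨C, hC⟩ := exists_prob_lt_of_close H hν hd le_rfl zero_lt_one ha0 le_rfl hε
      simp only [zero_mul] at hC
      refine ⟨C, ?_⟩
      rw [eventually_multiplesAtTop]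
      filter_upwards [hab, hC] with n hn1 hn2 hdvd
      refine lt_of_le_of_lt (le_of_eq ?_)
        (hn2 hdvd (meanFactorWeight H ν 0 n) (hn1 hdvd).1 (by simp))
      refine (hX n).measureReal_eq (S := {x | C * |meanFactorWeight H ν 0 n ^ (3 / 4 : ℝ)| <
        |minFactorWeight H 0 n x - meanFactorWeight H ν 0 n|}) ?_
      exact measurableSet_lt measurable_const
        ((measurable_minFactorWeight H hdvd le_rfl).sub_const _).abs
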